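/- Let $0<H<1$, $0<K\le 1$ and $T>0$. Let $W^{H,K}=\{W^{H,K}_t,\ 0\le t\le T\}$ be a bifractional Brownian motion with parameters $H,K$, that is, a centered Gaussian process with covariance function $$E[W^{H,K}_sW^{H,K}_t]=2^{-K}\left[(t^{2H}+s^{2H})^K-|s-t|^{2HK}\right],\qquad 0\le s,t\le T,$$ and let $W^{HK}=\{W^{HK}_t,\ 0\le t\le T\}$ be a fractional Brownian motion with Hurst index $HK$ (possibly on another probability space), that is, a centered Gaussian process with covariance function $\tfrac12\left(t^{2HK}+s^{2HK}-|t-s|^{2HK}\right)$. Assume that both processes have almost surely continuous sample paths on $[0,T]$, and put $Y^{(2)}_t=2^{-K/2}W^{HK}_t$. Then, for every non-decreasing convex function $g:[0,\infty)\to\mathbb R$, $$E\Big[g\Big(\sup_{0\le s,t\le T}(W^{H,K}_t-W^{H,K}_s)\Big)\Big]\ \ge\ E\Big[g\Big(\sup_{0\le s,t\le T}(Y^{(2)}_t-Y^{(2)}_s)\Big)\Big],$$ where the expectations take values in $(-\infty,\infty]$. Moreover, $\sup_{0\le t\le T}W^{H,K}_t$ and $\sup_{0\le t\le T}Y^{(2)}_t$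 are integrable and $$E\Big[\sup_{0\le t\le T}W^{H,K}_t\Big]\ \ge\ E\Big[\sup_{0\le t\le T}Y^{(2)}_t\Big].$$ -/

import Mathlib

open MeasureTheory ProbabilityTheory

/-- Covariance function `2⁻ᴷ ((t^{2H} + s^{2H})^K - |s - t|^{2HK})` of the bifractional Brownian
motion with parameters `H`, `K`, for times `s, t ≥ 0`. -/
noncomputable def bifBmCov (H K s t : ℝ) : ℝ :=
  1 / (2 : ℝ) ^ K * ((t ^ (2 * H) + s ^ (2 * H)) ^ K - |s - t| ^ (2 * H * K))

/-- Covariance function `(t^{2H} + s^{2H} - |t - s|^{2H}) / 2` of the fractional Brownian motion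
with Hurst index `H`, for times `s, t ≥ 0`. -/
noncomputable def fBmCov (H s t : ℝ) : ℝ :=
  1 / 2 * (t ^ (2 * H) + s ^ (2 * H) - |t - s| ^ (2 * H))

/-- `X` is a centered Gaussian process on the time interval `[0, T]`, under the probability
measure `P`, with covariance function `C`. -/
structure IsCenteredGaussianWithCov {Ω : Type*} [MeasurableSpace Ω] (T : ℝ) (C : ℝ → ℝ → ℝ)
    (X : Set.Icc (0 : ℝ) T → Ω → ℝ) (P : Measure Ω) : Prop where
  gaussian : IsGaussianProcess X P
  centered : ∀ t, ∫ ω, X t ω ∂P = 0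
  covariance_eq : ∀ s t, covariance (X s) (X t) P = C s t

/-- `W` is a bifractional Brownian motion on `[0, T]` with parameters `H`, `K`. -/
def IsBifractionalBM {Ω : Type*} [MeasurableSpace Ω] (H K T : ℝ)
    (W : Set.Icc (0 : ℝ) T → Ω → ℝ) (P : Measure Ω) : Prop :=
  IsCenteredGaussianWithCov T (bifBmCov H K) W P

/-- `B` is a fractional Brownian motion on `[0, T]` with Hurst index `H`. -/
def IsFractionalBM {Ω : Type*} [MeasurableSpace Ω] (H T : ℝ)
    (B : Set.Icc (0 : ℝ) T → Ω → ℝ) (P : Measure Ω) : Prop :=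
  IsCenteredGaussianWithCov T (fBmCov H) B P

/-- The expectation `E[f] = E[f⁺] - E[f⁻]` in `[-∞, ∞]` of a random variable `f` (which is
meaningful whenever `E[f⁺]` or `E[f⁻]` is finite, in particular for every `f` that is bounded
below). -/
noncomputable def extExpectation {Ω : Type*} [MeasurableSpace Ω] (P : Measure Ω) (f : Ω → ℝ) :
    EReal :=
  ((∫⁻ ω, ENNReal.ofReal (f ω) ∂P : ENNReal) : EReal)
    - ((∫⁻ ω, ENNReal.ofReal (-f ω) ∂P : ENNReal) : EReal)

/-! This is an instance of Fernique's comparison: for continuous centered Gaussian processes, larger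
increment variances make the range larger in the increasing convex order. The input needed is E(W_t
- W_s)² ≥ 2^{-K}|t - s|^{2HK}, which is `le_bifBmCov_increment`; with a = t^H and b = s^H it reduces
to `two_mul_add_rpow_le` and |a - b| ≤ |t - s|^H.

For finite vectors, β(max (x_k - x_l) - a)⁺ is smoothed to the log-sum-exp of 0 and all β(x_k - x_l
- a), and independent copies of the two vectors are rotated into each other. Gaussian integration by
parts makes the derivative a nonnegative factor times E[Σ w_p Δ_pp - Σ w_p w_q Δ_pq], with w the
softmax weights and Δ the difference of the two Gram matrices (`integral_logSumExp_le`). Ordering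
the increments of x does not order those of the pair variables x_k - x_l, so the sign is not a
term-by-term matter. It comes from the factorization w_{(k,l)} = u_k v_l together with
`sum_pair_kernel_le`.

Letting β → ∞ compares E(R - a)⁺ for every a ≥ 0. Mixtures of such functions approximate g
(`lintegral_convex_le`), and finite subsets of a dense sequence exhaust the range of a continuous
path. For the maximum, symmetry gives E[range] = 2 E[max], so a = 0 suffices; integrability and the
limit rest on a Fernique bound uniform in the dimension (`integrable_iSup_abs_path`). -/

/-! ### Comparison of the increment variances -/

/-- Normalized form of `two_mul_add_rpow_le`, with a² and b² proportional to 1 + h and 1 - h. -/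
theorem two_le_rpow_one_add_add_rpow_one_sub {K h : ℝ} (hK0 : 0 < K) (hK1 : K ≤ 1) (h0 : 0 ≤ h)
    (h1 : h ≤ 1) : 2 ≤ (1 + h) ^ K + (1 - h) ^ K + (h ^ 2 / 2) ^ K := by
  rcases h0.eq_or_lt with rfl | hpos
  · have : (0 : ℝ) ≤ ((0 : ℝ) ^ 2 / 2) ^ K := by positivity
    simp only [add_zero, sub_zero, Real.one_rpow]; linarith
  have h2K : (2 : ℝ) ^ K ≤ 1 + K := by
    have := rpow_one_add_le_one_add_mul_self (s := 1) (by norm_num) hK0.le hK1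
    norm_num at this; linarith
  have h2K1 : 1 ≤ (2 : ℝ) ^ K := Real.one_le_rpow (by norm_num) hK0.le
  have hdiv : (h ^ 2 / 2) ^ K = (h ^ 2) ^ K / 2 ^ K := Real.div_rpow (by positivity) (by norm_num) K
  rw [hdiv]
  -- For 2K ≤ 1 the term h^{2K} dominates h, and bounds linear in h suffice. Otherwise it is only
  -- bounded below by h², and the first two powers need bounds sharp to second order in h.
  rcases le_total K (1 / 2) with hK | hK
  · have e1 : 1 + ((2 : ℝ) ^ K - 1) * h ≤ (1 + h) ^ K := by
      have := (Real.concaveOn_rpow hK0.le hK1).2 (show (1 : ℝ) ∈ Set.Ici 0 by norm_num)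
        (show (2 : ℝ) ∈ Set.Ici 0 by norm_num) (show 0 ≤ 1 - h by linarith) h0 (by ring)
      simp only [smul_eq_mul, Real.one_rpow] at this
      calc _ = (1 - h) * 1 + h * 2 ^ K := by ring
        _ ≤ _ := this
        _ = _ := by ring_nf
    have e2 : 1 - h ≤ (1 - h) ^ K := Real.self_le_rpow_of_le_one (by linarith) (by linarith) hK1
    have e3 : h ≤ (h ^ 2) ^ K := by
      rw [← Real.rpow_natCast, ← Real.rpow_mul h0]
      exact Real.self_le_rpow_of_le_one h0 h1 (by push_cast; linarith)
    -- Amounts to 2^K(2 - 2^K) ≤ 1, that is (2^K - 1)² ≥ 0.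
    have e4 : (2 - 2 ^ K) * h ≤ (h ^ 2) ^ K / 2 ^ K := by
      rw [le_div_iff₀ (by positivity)]
      nlinarith [sq_nonneg ((2 : ℝ) ^ K - 1)]
    linarith
  -- Write (1 ± h)^K = (1 ± h)/(1 ± h)^{1-K} and apply Bernoulli to the denominator.
  · have e1 : (1 + h) / (1 + (1 - K) * h) ≤ (1 + h) ^ K := by
      have := rpow_one_add_le_one_add_mul_self (s := h) (by linarith) (p := 1 - K) (by linarith)
        (by linarith)
      rw [div_le_iff₀ (by nlinarith)]
      calc 1 + h = (1 + h) ^ K * (1 + h) ^ (1 - K) := by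
            rw [← Real.rpow_add (by linarith)]; simp
        _ ≤ _ := by gcongr
    have e2 : (1 - h) / (1 - (1 - K) * h) ≤ (1 - h) ^ K := by
      rcases h1.eq_or_lt with rfl | hlt
      · simp; positivity
      have := rpow_one_add_le_one_add_mul_self (s := -h) (by linarith) (p := 1 - K) (by linarith)
        (by linarith)
      rw [div_le_iff₀ (by nlinarith)]
      calc 1 - h = (1 - h) ^ K * (1 - h) ^ (1 - K) := by
            rw [← Real.rpow_add (by linarith)]; simp
        _ ≤ _ := by
            gcongr
            calc _ = (1 + -h) ^ (1 - K) := by ring_nf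
              _ ≤ _ := this
              _ = _ := by ring
    have e3 : h ^ 2 ≤ (h ^ 2) ^ K :=
      Real.self_le_rpow_of_le_one (by positivity) (by nlinarith) hK1
    have e4 : h ^ 2 / (1 + K) ≤ (h ^ 2) ^ K / 2 ^ K := by gcongr
    have e5 : 2 ≤ (1 + h) / (1 + (1 - K) * h) + (1 - h) / (1 - (1 - K) * h) + h ^ 2 / (1 + K) := by
      have p1 : 0 < 1 + (1 - K) * h := by nlinarith
      have p2 : 0 < 1 - (1 - K) * h := by nlinarith
      have p3 : 0 < 1 - ((1 - K) * h) ^ 2 := by nlinarith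
      have key : 2 - ((1 + h) / (1 + (1 - K) * h) + (1 - h) / (1 - (1 - K) * h)) =
          2 * (1 - K) * K * h ^ 2 / (1 - ((1 - K) * h) ^ 2) := by
        have e : 2 * (1 - K) * K * h ^ 2 = 2 * ((1 - K) * h) * h - 2 * ((1 - K) * h) ^ 2 := by ring
        rw [e]
        generalize (1 - K) * h = u at p1 p2 p3
        have q : 1 - u ^ 2 = (1 + u) * (1 - u) := by ring
        rw [q]
        have := p1.ne'
        have := p2.ne'
        field_simp
        ring
      have : 2 * (1 - K) * K * h ^ 2 / (1 - ((1 - K) * h) ^ 2) ≤ h ^ 2 / (1 + K) := by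
        rw [div_le_div_iff₀ p3 (by linarith)]
        have hh : h ^ 2 ≤ 1 := by nlinarith
        have q1 : 0 ≤ (1 - K) ^ 2 * (1 - h ^ 2) := mul_nonneg (sq_nonneg _) (by linarith)
        -- Equivalent to K²(2K - 1) ≥ 0; this is where K ≥ 1/2 is used.
        have q2 : 2 * (1 - K) * K * (1 + K) ≤ 1 - (1 - K) ^ 2 := by
          nlinarith [mul_nonneg hK0.le (mul_nonneg hK0.le (sub_nonneg.2 hK))]
        nlinarith [sq_nonneg h]
      linarith
    linarith

theorem two_mul_add_rpow_le {K a b : ℝ} (hK0 : 0 < K) (hK1 : K ≤ 1) (ha : 0 ≤ a) (hb : 0 ≤ b) :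
    2 * (a ^ 2 + b ^ 2) ^ K ≤ 2 ^ K * ((a ^ 2) ^ K + (b ^ 2) ^ K) + ((a - b) ^ 2) ^ K := by
  wlog hab : b ≤ a generalizing a b
  · have := this hb ha (le_of_not_ge hab)
    rw [add_comm (a ^ 2), add_comm ((a ^ 2) ^ K), sub_sq_comm]; exact this
  rcases ha.eq_or_lt with rfl | hpos
  · obtain rfl : b = 0 := le_antisymm hab hb
    simp [Real.zero_rpow hK0.ne']
  set m := (a ^ 2 + b ^ 2) / 2 with hm
  have hm0 : 0 < m := by positivity
  set h := (a ^ 2 - b ^ 2) / (a ^ 2 + b ^ 2) with hh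
  have h0 : 0 ≤ h := by
    apply div_nonneg _ (by positivity); nlinarith
  have h1 : h ≤ 1 := by
    rw [hh, div_le_one (by positivity)]; nlinarith
  have ea : a ^ 2 = m * (1 + h) := by rw [hm, hh]; field_simp; ring
  have eb : b ^ 2 = m * (1 - h) := by rw [hm, hh]; field_simp; ring
  have eab : a ^ 2 + b ^ 2 = 2 * m := by rw [hm]; ring
  -- The quotient of the two sides is (a + b)²/(2(a² + b²)) ≤ 1.
  have hd : 2 * m * (h ^ 2 / 2) ≤ (a - b) ^ 2 := by
    have : 2 * m * (h ^ 2 / 2) = (a - b) ^ 2 * ((a + b) ^ 2 / (2 * (a ^ 2 + b ^ 2))) := by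
      rw [hm, hh]; field_simp; ring
    rw [this]
    apply mul_le_of_le_one_right (sq_nonneg _)
    rw [div_le_one (by positivity)]; nlinarith [sq_nonneg (a - b)]
  have hd' : (2 * m) ^ K * (h ^ 2 / 2) ^ K ≤ ((a - b) ^ 2) ^ K := by
    rw [← Real.mul_rpow (by positivity) (by positivity)]
    exact Real.rpow_le_rpow (by positivity) hd hK0.le
  have key := mul_le_mul_of_nonneg_left (two_le_rpow_one_add_add_rpow_one_sub hK0 hK1 h0 h1)
    (show 0 ≤ (2 * m) ^ K by positivity)
  rw [eab, ea, eb, Real.mul_rpow hm0.le (by linarith), Real.mul_rpow hm0.le (by linarith)]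
  have e : (2 * m) ^ K = 2 ^ K * m ^ K := Real.mul_rpow (by norm_num) hm0.le
  rw [e] at key hd' ⊢
  linarith

theorem abs_rpow_sub_rpow_le {H s t : ℝ} (hH0 : 0 < H) (hH1 : H ≤ 1) (hs : 0 ≤ s) (ht : 0 ≤ t) :
    |t ^ H - s ^ H| ≤ |t - s| ^ H := by
  wlog hst : s ≤ t generalizing s t
  · rw [abs_sub_comm, abs_sub_comm t]; exact this ht hs (le_of_not_ge hst)
  have h1 := Real.rpow_add_le_add_rpow hs (sub_nonneg.2 hst) hH0.le hH1
  rw [add_sub_cancel] at h1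
  rw [abs_of_nonneg (sub_nonneg.2 (Real.rpow_le_rpow hs hst hH0.le)),
    abs_of_nonneg (sub_nonneg.2 hst)]
  linarith

theorem fBmCov_increment {H s t : ℝ} (hH : 0 < H) :
    fBmCov H t t + fBmCov H s s - 2 * fBmCov H s t = |t - s| ^ (2 * H) := by
  simp only [fBmCov, sub_self, abs_zero, Real.zero_rpow (mul_pos two_pos hH).ne']
  ring

/-- Multiplied by 2^K, this is `two_mul_add_rpow_le` at a = t^H, b = s^H, after (a - b)² is replaced
by the larger |t - s|^{2H}. -/
theorem le_bifBmCov_increment {H K s t : ℝ} (hH0 : 0 < H) (hH1 : H < 1) (hK0 : 0 < K) (hK1 : K ≤ 1)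
    (hs : 0 ≤ s) (ht : 0 ≤ t) :
    1 / (2 : ℝ) ^ K * |t - s| ^ (2 * (H * K)) ≤
      bifBmCov H K t t + bifBmCov H K s s - 2 * bifBmCov H K s t := by
  have hp : 0 < 2 * H * K := by positivity
  have e (x : ℝ) (hx : 0 ≤ x) : x ^ (2 * H) = (x ^ H) ^ 2 := by
    rw [← Real.rpow_natCast, ← Real.rpow_mul hx]; norm_num [mul_comm]
  have key := two_mul_add_rpow_le hK0 hK1 (Real.rpow_nonneg ht H) (Real.rpow_nonneg hs H)
  have hd : ((t ^ H - s ^ H) ^ 2) ^ K ≤ |t - s| ^ (2 * H * K) := by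
    rw [Real.rpow_mul (abs_nonneg _), e _ (abs_nonneg _), ← sq_abs (t ^ H - s ^ H)]
    have := abs_rpow_sub_rpow_le hH0 hH1.le hs ht
    gcongr
  have hself (x : ℝ) : ((x ^ H) ^ 2 + (x ^ H) ^ 2) ^ K = 2 ^ K * ((x ^ H) ^ 2) ^ K := by
    rw [← two_mul, Real.mul_rpow (by norm_num) (by positivity)]
  simp only [bifBmCov, sub_self, abs_zero, Real.zero_rpow hp.ne', sub_zero, e t ht, e s hs, hself]
  rw [abs_sub_comm s t, ← mul_assoc 2 H K]
  have h2 : (0 : ℝ) < 2 ^ K := by positivity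
  have : 1 / (2 : ℝ) ^ K * (2 ^ K * ((t ^ H) ^ 2) ^ K) + 1 / (2 : ℝ) ^ K * (2 ^ K * ((s ^ H) ^ 2) ^ K)
      - 2 * (1 / (2 : ℝ) ^ K * (((t ^ H) ^ 2 + (s ^ H) ^ 2) ^ K - |t - s| ^ (2 * H * K)))
      - 1 / (2 : ℝ) ^ K * |t - s| ^ (2 * H * K)
      = 1 / (2 : ℝ) ^ K * (2 ^ K * (((t ^ H) ^ 2) ^ K + ((s ^ H) ^ 2) ^ K) + |t - s| ^ (2 * H * K)
        - 2 * ((t ^ H) ^ 2 + (s ^ H) ^ 2) ^ K) := by ring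
  have h3 : 0 ≤ 1 / (2 : ℝ) ^ K * (2 ^ K * (((t ^ H) ^ 2) ^ K + ((s ^ H) ^ 2) ^ K)
      + |t - s| ^ (2 * H * K) - 2 * ((t ^ H) ^ 2 + (s ^ H) ^ 2) ^ K) :=
    mul_nonneg (by positivity) (by linarith)
  linarith

/-! ### Gaussian integration by parts -/

theorem hasDerivAt_gaussianPDFReal (x : ℝ) :
    HasDerivAt (gaussianPDFReal 0 1) (-x * gaussianPDFReal 0 1 x) x := by
  have : gaussianPDFReal 0 1 = fun x => (√(2 * Real.pi * (1 : NNReal)))⁻¹ *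
      Real.exp (-(x - 0) ^ 2 / (2 * (1 : NNReal))) := rfl
  rw [this]
  have h : HasDerivAt (fun x : ℝ => -(x - 0) ^ 2 / (2 * ((1 : NNReal) : ℝ))) (-x) x := by
    have := (((hasDerivAt_id x).sub_const 0).pow 2).neg.div_const (2 * ((1 : NNReal) : ℝ))
    convert! this using 1
    simp only [NNReal.coe_one, id, sub_zero]
    norm_num
    ring
  convert! (h.exp.const_mul _) using 1
  ring

/-- Gaussian integration by parts on the line. -/
theorem integral_id_mul_gaussianReal {f f' : ℝ → ℝ} {C : ℝ} (hf : ∀ x, HasDerivAt f (f' x) x)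
    (hf' : Continuous f') (hC : ∀ x, |f x| ≤ C) (hC' : ∀ x, |f' x| ≤ C) :
    ∫ x, x * f x ∂gaussianReal 0 1 = ∫ x, f' x ∂gaussianReal 0 1 := by
  have hfc : Continuous f := continuous_iff_continuousAt.2 fun x => (hf x).continuousAt
  have i1 : Integrable (gaussianPDFReal 0 1) := integrable_gaussianPDFReal 0 1
  have i2 : Integrable (fun x => gaussianPDFReal 0 1 x * x) := by
    have : Integrable (fun x : ℝ => x) (gaussianReal 0 1) :=
      memLp_one_iff_integrable.1 (memLp_id_gaussianReal' 1 (by simp))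
    rw [gaussianReal_of_var_ne_zero _ (by simp), integrable_withDensity_iff_integrable_smul₀'
      (by fun_prop) (by simp [gaussianPDF])] at this
    simpa [toReal_gaussianPDF] using this
  have key := integral_mul_deriv_eq_deriv_mul_of_integrable (u := f) (u' := f')
    (v := gaussianPDFReal 0 1) (v' := fun x => -x * gaussianPDFReal 0 1 x)
    (fun x _ => hf x) (fun x _ => hasDerivAt_gaussianPDFReal x)
    (by
      refine (i2.bdd_mul (c := C) hfc.aestronglyMeasurable (ae_of_all _ hC)).neg.congr
        (ae_of_all _ fun x => ?_)
      simp only [Pi.neg_apply, Pi.mul_apply]; ring)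
    (i1.bdd_mul (c := C) hf'.aestronglyMeasurable (ae_of_all _ hC'))
    (i1.bdd_mul (c := C) hfc.aestronglyMeasurable (ae_of_all _ hC))
  simp only [integral_gaussianReal_eq_integral_smul (one_ne_zero : (1 : NNReal) ≠ 0), smul_eq_mul]
  calc _ = - ∫ x, f x * (-x * gaussianPDFReal 0 1 x) := by
        rw [← integral_neg]; congr 1; ext x; ring
    _ = _ := by rw [key, neg_neg]; congr 1; ext x; ring

/-- The standard Gaussian measure on `Fin m → ℝ`. -/
noncomputable abbrev stdGaussianPi (m : ℕ) : Measure (Fin m → ℝ) :=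
  Measure.pi fun _ => gaussianReal 0 1

theorem integrable_eval_stdGaussianPi {m : ℕ} (k : Fin m) :
    Integrable (fun ξ => ξ k) (stdGaussianPi m) :=
  integrable_eval (i := k) (memLp_one_iff_integrable.1 (memLp_id_gaussianReal' 1 (by simp)))

/-- Gaussian integration by parts in one coordinate. -/
theorem integral_eval_mul_stdGaussianPi {m : ℕ} (k : Fin m) {f f' : (Fin m → ℝ) → ℝ} {C : ℝ}
    (hfc : Continuous f) (hf : ∀ ξ x, HasDerivAt (fun y => f (Function.update ξ k y))
      (f' (Function.update ξ k x)) x)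
    (hf' : Continuous f') (hC : ∀ x, |f x| ≤ C) (hC' : ∀ x, |f' x| ≤ C) :
    ∫ ξ, ξ k * f ξ ∂stdGaussianPi m = ∫ ξ, f' ξ ∂stdGaussianPi m := by
  cases m with
  | zero => exact k.elim0
  | succ n =>
  have hmp := (measurePreserving_piFinSuccAbove (fun _ : Fin (n + 1) => gaussianReal 0 1) k).symm
  rw [stdGaussianPi, ← hmp.integral_comp', ← hmp.integral_comp']
  have i1 : Integrable (fun ξ => ξ k * f ξ) (stdGaussianPi (n + 1)) :=
    (integrable_eval_stdGaussianPi k).mul_bdd (c := C) hfc.aestronglyMeasurable (ae_of_all _ hC)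
  have i2 : Integrable f' (stdGaussianPi (n + 1)) :=
    Integrable.of_bound hf'.aestronglyMeasurable C (ae_of_all _ hC')
  rw [integral_prod_symm _ (by exact hmp.integrable_comp_of_integrable i1),
    integral_prod_symm _ (by exact hmp.integrable_comp_of_integrable i2)]
  congr 1
  ext η
  have hupd (x : ℝ) : (MeasurableEquiv.piFinSuccAbove (fun _ : Fin (n + 1) => ℝ) k).symm (x, η) =
      Function.update (k.insertNth (0 : ℝ) η : Fin (n + 1) → ℝ) k x := by
    simp [MeasurableEquiv.piFinSuccAbove, Fin.insertNthEquiv]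
  simp only [hupd, Function.update_self]
  exact integral_id_mul_gaussianReal (hf _) (by fun_prop) (fun x => hC _) (fun x => hC' _)

/-! ### Log-sum-exp, softmax and Gaussian interpolation -/

section LogSumExp

variable {ι : Type*} [Fintype ι] [Nonempty ι]

/-- The log-sum-exp function. -/
noncomputable def logSumExp (y : ι → ℝ) : ℝ := Real.log (∑ p, Real.exp (y p))

/-- The softmax weights, which form the gradient of `logSumExp`. -/
noncomputable def softmax (y : ι → ℝ) (p : ι) : ℝ := Real.exp (y p) / ∑ q, Real.exp (y q)

theorem sum_exp_pos (y : ι → ℝ) : 0 < ∑ q, Real.exp (y q) :=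
  Finset.sum_pos (fun _ _ => Real.exp_pos _) Finset.univ_nonempty

theorem softmax_nonneg (y : ι → ℝ) (p : ι) : 0 ≤ softmax y p :=
  div_nonneg (Real.exp_pos _).le (sum_exp_pos y).le

theorem sum_softmax (y : ι → ℝ) : ∑ p, softmax y p = 1 := by
  simp only [softmax, ← Finset.sum_div]
  exact div_self (sum_exp_pos y).ne'

theorem softmax_le_one (y : ι → ℝ) (p : ι) : softmax y p ≤ 1 := by
  rw [← sum_softmax y]
  exact Finset.single_le_sum (fun q _ => softmax_nonneg y q) (Finset.mem_univ p)

theorem continuous_softmax (p : ι) : Continuous fun y : ι → ℝ => softmax y p := by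
  unfold softmax
  exact Continuous.div (by fun_prop) (by fun_prop) fun y => (sum_exp_pos y).ne'

theorem continuous_logSumExp : Continuous (logSumExp : (ι → ℝ) → ℝ) := by
  unfold logSumExp
  exact Continuous.log (by fun_prop) fun y => (sum_exp_pos y).ne'

omit [Nonempty ι] in
theorem hasDerivAt_sum_exp {y : ℝ → ι → ℝ} {y' : ι → ℝ} {t : ℝ}
    (h : ∀ p, HasDerivAt (fun s => y s p) (y' p) t) :
    HasDerivAt (fun s => ∑ p, Real.exp (y s p)) (∑ p, Real.exp (y t p) * y' p) t :=
  HasDerivAt.fun_sum fun p _ => (h p).exp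

theorem HasDerivAt.logSumExp {y : ℝ → ι → ℝ} {y' : ι → ℝ} {t : ℝ}
    (h : ∀ p, HasDerivAt (fun s => y s p) (y' p) t) :
    HasDerivAt (fun s => logSumExp (y s)) (∑ p, softmax (y t) p * y' p) t := by
  convert! (hasDerivAt_sum_exp h).log (sum_exp_pos _).ne' using 1
  rw [Finset.sum_div]
  exact Finset.sum_congr rfl fun p _ => by rw [softmax, div_mul_eq_mul_div]

theorem HasDerivAt.softmax {y : ℝ → ι → ℝ} {y' : ι → ℝ} {t : ℝ}
    (h : ∀ p, HasDerivAt (fun s => y s p) (y' p) t) (p : ι) :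
    HasDerivAt (fun s => softmax (y s) p)
      (softmax (y t) p * (y' p - ∑ q, softmax (y t) q * y' q)) t := by
  convert! (h p).exp.div (hasDerivAt_sum_exp h) (sum_exp_pos _).ne' using 1
  have : ∑ q, _root_.softmax (y t) q * y' q = (∑ q, Real.exp (y t q) * y' q) /
      ∑ q, Real.exp (y t q) := by
    rw [Finset.sum_div]
    exact Finset.sum_congr rfl fun p _ => by rw [_root_.softmax, div_mul_eq_mul_div]
  rw [this, _root_.softmax]
  have := (sum_exp_pos (y t)).ne'
  field_simp

theorem abs_sum_softmax_mul_le (y v : ι → ℝ) : |∑ p, softmax y p * v p| ≤ ∑ p, |v p| := by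
  refine (Finset.abs_sum_le_sum_abs _ _).trans (Finset.sum_le_sum fun p _ => ?_)
  rw [abs_mul, abs_of_nonneg (softmax_nonneg y p)]
  exact mul_le_of_le_one_left (abs_nonneg _) (softmax_le_one y p)

theorem le_logSumExp (y : ι → ℝ) (p : ι) : y p ≤ logSumExp y := by
  rw [logSumExp, Real.le_log_iff_exp_le (sum_exp_pos y)]
  exact Finset.single_le_sum (f := fun q => Real.exp (y q)) (fun q _ => (Real.exp_pos _).le)
    (Finset.mem_univ p)

/-- Together with `le_logSumExp`, this puts log-sum-exp within log |ι| of the maximum. The error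
does not grow when y is scaled by β, so it vanishes after division by β. -/
theorem logSumExp_le {y : ι → ℝ} {b : ℝ} (h : ∀ p, y p ≤ b) :
    logSumExp y ≤ b + Real.log (Fintype.card ι) := by
  have : ∑ q, Real.exp (y q) ≤ Fintype.card ι * Real.exp b := by
    calc _ ≤ ∑ q : ι, Real.exp b := Finset.sum_le_sum fun q _ => Real.exp_le_exp.2 (h q)
      _ = _ := by simp
  calc _ ≤ Real.log (Fintype.card ι * Real.exp b) := Real.log_le_log (sum_exp_pos y) this
    _ = _ := by
      rw [Real.log_mul (by simp) (Real.exp_pos b).ne', Real.log_exp, add_comm]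

theorem abs_logSumExp_le (y : ι → ℝ) :
    |logSumExp y| ≤ ∑ p, |y p| + Real.log (Fintype.card ι) := by
  have hle (p : ι) : |y p| ≤ ∑ p, |y p| :=
    Finset.single_le_sum (f := fun q => |y q|) (fun q _ => abs_nonneg _) (Finset.mem_univ p)
  have h0 : 0 ≤ Real.log (Fintype.card ι) := Real.log_natCast_nonneg _
  rw [abs_le]
  constructor
  · obtain ⟨p⟩ := ‹Nonempty ι›
    linarith [neg_abs_le (y p), le_logSumExp y p, hle p]
  · exact logSumExp_le fun p => (le_abs_self _).trans (hle p)

variable {m : ℕ}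

theorem integrable_sum_mul_stdGaussianPi (v : Fin m → ℝ) :
    Integrable (fun ξ : Fin m → ℝ => ∑ k, v k * ξ k) (stdGaussianPi m) :=
  integrable_finsetSum _ fun k _ => (integrable_eval_stdGaussianPi k).const_mul _

omit [Fintype ι] [Nonempty ι] in
theorem continuous_affine (M : ι → Fin m → ℝ) (c : ι → ℝ) :
    Continuous fun (ξ : Fin m → ℝ) (p : ι) => ∑ k, M p k * ξ k + c p := by
  fun_prop

theorem integrable_logSumExp_stdGaussianPi (M : ι → Fin m → ℝ) (c : ι → ℝ) :
    Integrable (fun ξ : Fin m → ℝ => logSumExp fun p => ∑ k, M p k * ξ k + c p)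
      (stdGaussianPi m) := by
  have h : Integrable (fun ξ : Fin m → ℝ => ∑ p, |∑ k, M p k * ξ k + c p| +
      Real.log (Fintype.card ι)) (stdGaussianPi m) :=
    (integrable_finsetSum _ fun p _ => ((integrable_sum_mul_stdGaussianPi (M p)).add
      (integrable_const _)).abs).add (integrable_const _)
  exact h.mono' (continuous_logSumExp.comp (continuous_affine M c)).aestronglyMeasurable
    (ae_of_all _ fun ξ => abs_logSumExp_le _)

theorem integral_eval_mul_softmax (M : ι → Fin m → ℝ) (c : ι → ℝ) (k : Fin m) (p : ι) :
    ∫ ξ, ξ k * softmax (fun p => ∑ k, M p k * ξ k + c p) p ∂stdGaussianPi m =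
      ∫ ξ, softmax (fun p => ∑ k, M p k * ξ k + c p) p *
        (M p k - ∑ q, softmax (fun p => ∑ k, M p k * ξ k + c p) q * M q k) ∂stdGaussianPi m := by
  have hc (q : ι) : Continuous fun ξ : Fin m → ℝ => softmax (fun p => ∑ k, M p k * ξ k + c p) q :=
    (continuous_softmax q).comp (continuous_affine M c)
  -- One constant has to bound both the weight (by 1) and its derivative (by the remaining sum).
  refine integral_eval_mul_stdGaussianPi k (C := 1 + (|M p k| + ∑ q, |M q k|)) (hc p) ?_ ?_ ?_ ?_
  · intro ξ x
    refine HasDerivAt.softmax (y := fun s p => ∑ j, M p j * Function.update ξ k s j + c p)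
      (y' := fun q => M q k) (t := x) (fun q => ?_) p
    have : HasDerivAt (fun s => ∑ j, M q j * Function.update ξ k s j)
        (∑ j, M q j * (Pi.single k (1 : ℝ) : Fin m → ℝ) j) x :=
      HasDerivAt.fun_sum fun j _ => (hasDerivAt_pi.1 (hasDerivAt_update ξ k x) j).const_mul _
    convert! this.add_const (c q) using 1
    simp [Pi.single_apply]
  · exact (hc p).mul (continuous_const.sub (continuous_finsetSum _ fun q _ =>
      (hc q).mul continuous_const))
  · intro ξ
    rw [abs_of_nonneg (softmax_nonneg _ _)]
    have : 0 ≤ |M p k| + ∑ q, |M q k| := by positivity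
    linarith [softmax_le_one (fun p => ∑ k, M p k * ξ k + c p) p]
  · intro ξ
    rw [abs_mul, abs_of_nonneg (softmax_nonneg _ _)]
    calc _ ≤ _ := mul_le_of_le_one_left (abs_nonneg _) (softmax_le_one _ _)
      _ ≤ _ := abs_sub _ _
      _ ≤ |M p k| + ∑ q, |M q k| := by gcongr; exact abs_sum_softmax_mul_le _ _
      _ ≤ _ := by linarith

/-- Integration by parts in each coordinate removes the linear factors ξ_k and leaves only inner
products of rows of N and M. It is applied with N the derivative of M along the interpolation. -/
theorem integral_sum_softmax_mul (M N : ι → Fin m → ℝ) (c : ι → ℝ) :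
    ∫ ξ, ∑ p, softmax (fun p => ∑ k, M p k * ξ k + c p) p * ∑ k, N p k * ξ k ∂stdGaussianPi m =
      ∫ ξ, (∑ p, softmax (fun p => ∑ k, M p k * ξ k + c p) p * ∑ k, N p k * M p k -
        ∑ p, ∑ q, softmax (fun p => ∑ k, M p k * ξ k + c p) p *
          softmax (fun p => ∑ k, M p k * ξ k + c p) q * ∑ k, N p k * M q k) ∂stdGaussianPi m := by
  have hc (q : ι) : Continuous fun ξ : Fin m → ℝ => softmax (fun p => ∑ k, M p k * ξ k + c p) q :=
    (continuous_softmax q).comp (continuous_affine M c)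
  have i1 (p : ι) (k : Fin m) : Integrable
      (fun ξ : Fin m → ℝ => ξ k * softmax (fun p => ∑ k, M p k * ξ k + c p) p)
      (stdGaussianPi m) :=
    (integrable_eval_stdGaussianPi k).mul_bdd (c := 1) (hc p).aestronglyMeasurable
      (ae_of_all _ fun ξ => by
        rw [Real.norm_of_nonneg (softmax_nonneg _ _)]; exact softmax_le_one _ _)
  have i2 (p : ι) (k : Fin m) : Integrable
      (fun ξ : Fin m → ℝ => softmax (fun p => ∑ k, M p k * ξ k + c p) p *
        (M p k - ∑ q, softmax (fun p => ∑ k, M p k * ξ k + c p) q * M q k)) (stdGaussianPi m) := by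
    refine Integrable.of_bound (C := |M p k| + ∑ q, |M q k|) ?_ (ae_of_all _ fun ξ => ?_)
    · exact ((hc p).mul (continuous_const.sub (continuous_finsetSum _ fun q _ =>
        (hc q).mul continuous_const))).aestronglyMeasurable
    · rw [Real.norm_eq_abs, abs_mul, abs_of_nonneg (softmax_nonneg _ _)]
      calc _ ≤ _ := mul_le_of_le_one_left (abs_nonneg _) (softmax_le_one _ _)
        _ ≤ _ := abs_sub _ _
        _ ≤ |M p k| + ∑ q, |M q k| := by gcongr; exact abs_sum_softmax_mul_le _ _
  calc _ = ∫ ξ, ∑ p, ∑ k, N p k * (ξ k * softmax (fun p => ∑ k, M p k * ξ k + c p) p)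
        ∂stdGaussianPi m := by
        congr 1; ext ξ
        refine Finset.sum_congr rfl fun p _ => ?_
        rw [Finset.mul_sum]
        exact Finset.sum_congr rfl fun k _ => by ring
    _ = ∑ p, ∑ k, N p k * ∫ ξ, ξ k * softmax (fun p => ∑ k, M p k * ξ k + c p) p
        ∂stdGaussianPi m := by
        rw [integral_finsetSum _ fun p _ => integrable_finsetSum _ fun k _ => (i1 p k).const_mul _]
        refine Finset.sum_congr rfl fun p _ => ?_
        rw [integral_finsetSum _ fun k _ => (i1 p k).const_mul _]
        exact Finset.sum_congr rfl fun k _ => integral_const_mul _ _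
    _ = ∑ p, ∑ k, N p k * ∫ ξ, softmax (fun p => ∑ k, M p k * ξ k + c p) p *
        (M p k - ∑ q, softmax (fun p => ∑ k, M p k * ξ k + c p) q * M q k) ∂stdGaussianPi m := by
        simp only [integral_eval_mul_softmax M c]
    _ = ∫ ξ, ∑ p, ∑ k, N p k * (softmax (fun p => ∑ k, M p k * ξ k + c p) p *
        (M p k - ∑ q, softmax (fun p => ∑ k, M p k * ξ k + c p) q * M q k)) ∂stdGaussianPi m := by
        rw [integral_finsetSum _ fun p _ => integrable_finsetSum _ fun k _ => (i2 p k).const_mul _]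
        refine Finset.sum_congr rfl fun p _ => ?_
        rw [integral_finsetSum _ fun k _ => (i2 p k).const_mul _]
        exact Finset.sum_congr rfl fun k _ => (integral_const_mul _ _).symm
    _ = _ := by
        congr 1; ext ξ
        rw [← Finset.sum_sub_distrib]
        refine Finset.sum_congr rfl fun p _ => ?_
        generalize softmax (fun p => ∑ k, M p k * ξ k + c p) = w
        simp only [Finset.mul_sum, mul_sub, Finset.sum_sub_distrib]
        congr 1
        · exact Finset.sum_congr rfl fun k _ => by ring
        · rw [Finset.sum_comm]
          exact Finset.sum_congr rfl fun q _ => Finset.sum_congr rfl fun k _ => by ring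

/-- Interpolation comparison for the expected log-sum-exp of Gaussian vectors `A ξ + c` and
`B ξ + c`, where the rows of `A` are orthogonal to the rows of `B`. -/
theorem integral_logSumExp_le (A B : ι → Fin m → ℝ) (c : ι → ℝ)
    (horth : ∀ p q, ∑ k, A p k * B q k = 0)
    (hpos : ∀ (s t : ℝ) (ξ : Fin m → ℝ) (w : ι → ℝ),
      w = softmax (fun p => ∑ k, (s * A p k + t * B p k) * ξ k + c p) →
      0 ≤ ∑ p, w p * ∑ k, (B p k * B p k - A p k * A p k) -
        ∑ p, ∑ q, w p * w q * ∑ k, (B p k * B q k - A p k * A q k)) :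
    ∫ ξ, logSumExp (fun p => ∑ k, A p k * ξ k + c p) ∂stdGaussianPi m ≤
      ∫ ξ, logSumExp (fun p => ∑ k, B p k * ξ k + c p) ∂stdGaussianPi m := by
  -- A rotation from A at θ = 0 to B at θ = π/2, with N its derivative in θ.
  set M : ℝ → ι → Fin m → ℝ := fun θ p k => Real.cos θ * A p k + Real.sin θ * B p k with hM
  set N : ℝ → ι → Fin m → ℝ := fun θ p k => -Real.sin θ * A p k + Real.cos θ * B p k with hN
  set φ : ℝ → ℝ := fun θ => ∫ ξ, logSumExp (fun p => ∑ k, M θ p k * ξ k + c p) ∂stdGaussianPi m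
    with hφ
  have hMN (θ : ℝ) (p : ι) (k : Fin m) : HasDerivAt (fun θ => M θ p k) (N θ p k) θ :=
    ((Real.hasDerivAt_cos θ).mul_const _).add ((Real.hasDerivAt_sin θ).mul_const _)
  have hNle (θ : ℝ) (p : ι) (k : Fin m) : |N θ p k| ≤ |A p k| + |B p k| := by
    refine (abs_add_le _ _).trans ?_
    rw [abs_mul, abs_mul, abs_neg]
    exact add_le_add (mul_le_of_le_one_left (abs_nonneg _) (Real.abs_sin_le_one θ))
      (mul_le_of_le_one_left (abs_nonneg _) (Real.abs_cos_le_one θ))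
  have hφd (θ : ℝ) : HasDerivAt φ (∫ ξ, ∑ p, softmax (fun p => ∑ k, M θ p k * ξ k + c p) p *
      ∑ k, N θ p k * ξ k ∂stdGaussianPi m) θ := by
    refine (hasDerivAt_integral_of_dominated_loc_of_deriv_le (μ := stdGaussianPi m)
      (F := fun θ ξ => logSumExp (fun p => ∑ k, M θ p k * ξ k + c p))
      (F' := fun θ ξ => ∑ p, softmax (fun p => ∑ k, M θ p k * ξ k + c p) p *
        ∑ k, N θ p k * ξ k)
      (bound := fun ξ => ∑ p, ∑ k, (|A p k| + |B p k|) * |ξ k|)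
      (s := Set.univ) Filter.univ_mem ?_ ?_ ?_ ?_ ?_ ?_).2
    · exact Filter.Eventually.of_forall fun θ =>
        (integrable_logSumExp_stdGaussianPi (M θ) c).aestronglyMeasurable
    · exact integrable_logSumExp_stdGaussianPi (M θ) c
    · refine Continuous.aestronglyMeasurable (continuous_finsetSum _ fun p _ => ?_)
      exact ((continuous_softmax p).comp (continuous_affine (M θ) c)).mul (by fun_prop)
    · refine ae_of_all _ fun ξ θ _ => ?_
      refine (abs_sum_softmax_mul_le _ _).trans (Finset.sum_le_sum fun p _ => ?_)
      refine (Finset.abs_sum_le_sum_abs _ _).trans (Finset.sum_le_sum fun k _ => ?_)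
      rw [abs_mul]
      gcongr
      exact hNle θ p k
    · exact integrable_finsetSum _ fun p _ => integrable_finsetSum _ fun k _ =>
        (integrable_eval_stdGaussianPi k).abs.const_mul _
    · refine ae_of_all _ fun ξ θ _ => ?_
      refine HasDerivAt.logSumExp (y := fun θ p => ∑ k, M θ p k * ξ k + c p) fun p => ?_
      exact (HasDerivAt.fun_sum fun k _ => (hMN θ p k).mul_const _).add_const _
  -- Orthogonality of the rows kills the cos² and sin² terms, leaving the difference of Gram
  -- matrices.
  have hinner (θ : ℝ) (p q : ι) : ∑ k, N θ p k * M θ q k = Real.sin θ * Real.cos θ *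
      ∑ k, (B p k * B q k - A p k * A q k) := by
    have h1 := horth q p
    have h2 := horth p q
    have : ∑ k, N θ p k * M θ q k = Real.sin θ * Real.cos θ *
        ∑ k, (B p k * B q k - A p k * A q k) + Real.cos θ ^ 2 * ∑ k, A q k * B p k
        - Real.sin θ ^ 2 * ∑ k, A p k * B q k := by
      simp only [Finset.mul_sum, ← Finset.sum_add_distrib, ← Finset.sum_sub_distrib, hM, hN]
      exact Finset.sum_congr rfl fun k _ => by ring
    rw [this, h1, h2]; ring
  have hmono : MonotoneOn φ (Set.Icc 0 (Real.pi / 2)) := by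
    refine monotoneOn_of_deriv_nonneg (convex_Icc _ _)
      (fun θ _ => (hφd θ).continuousAt.continuousWithinAt)
      (fun θ _ => (hφd θ).differentiableAt.differentiableWithinAt) fun θ hθ => ?_
    rw [interior_Icc] at hθ
    rw [(hφd θ).deriv, integral_sum_softmax_mul]
    refine integral_nonneg fun ξ => ?_
    -- The sign condition is needed only at softmax weights of interpolated points, which is what
    -- lets the factorization of these weights be used later.
    have h := hpos (Real.cos θ) (Real.sin θ) ξ _ rfl
    have hsc : 0 ≤ Real.sin θ * Real.cos θ :=
      mul_nonneg (Real.sin_nonneg_of_nonneg_of_le_pi hθ.1.le (by linarith [hθ.2, Real.pi_pos]))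
        (Real.cos_nonneg_of_neg_pi_div_two_le_of_le (by linarith [hθ.1, Real.pi_pos]) hθ.2.le)
    simp only [hinner, Pi.zero_apply]
    convert! mul_nonneg hsc h using 1
    rw [mul_sub, Finset.mul_sum, Finset.mul_sum]
    congr 1
    · exact Finset.sum_congr rfl fun p _ => by ring
    · refine Finset.sum_congr rfl fun p _ => ?_
      rw [Finset.mul_sum]
      exact Finset.sum_congr rfl fun q _ => by ring
  have h := hmono (Set.left_mem_Icc.2 (by positivity)) (Set.right_mem_Icc.2 (by positivity))
    (by positivity)
  simpa [hφ, hM] using h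

end LogSumExp

/-! ### The quadratic form on pairs under product weights -/

section Quadruple

variable {κ : Type*} [Fintype κ]

/-- A nonnegative-increment symmetric kernel `g` satisfies a Cauchy-Schwarz type inequality for the
induced kernel on pairs `(k, l) ↦ δ_k - δ_l`, averaged over product weights. -/
theorem sum_pair_kernel_le (u v : κ → ℝ) (g : κ → κ → ℝ) (hu : ∀ k, 0 ≤ u k) (hv : ∀ k, 0 ≤ v k)
    (hsymm : ∀ k l, g k l = g l k) (hg : ∀ k l, 0 ≤ g k k + g l l - 2 * g k l) :
    ∑ k, ∑ l, ∑ k', ∑ l', u k * v l * (u k' * v l') * (g k k' - g k l' - g l k' + g l l') ≤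
      ∑ k, ∑ l, ∑ k', ∑ l', u k * v l * (u k' * v l') * (g k k + g l l - 2 * g k l) := by
  -- Product weights are invariant under k ↔ k' and, separately, under l ↔ l'.
  have swap_fst (f : κ → κ → κ → κ → ℝ) :
      ∑ k, ∑ l, ∑ k', ∑ l', u k * v l * (u k' * v l') * f k l k' l' =
      ∑ k, ∑ l, ∑ k', ∑ l', u k * v l * (u k' * v l') * f k' l k l' := by
    rw [Finset.sum_comm]
    conv_rhs => rw [Finset.sum_comm]
    refine Finset.sum_congr rfl fun l _ => ?_
    rw [Finset.sum_comm]
    exact Finset.sum_congr rfl fun k _ => Finset.sum_congr rfl fun k' _ =>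
      Finset.sum_congr rfl fun l' _ => by ring
  have swap_snd (f : κ → κ → κ → κ → ℝ) :
      ∑ k, ∑ l, ∑ k', ∑ l', u k * v l * (u k' * v l') * f k l k' l' =
      ∑ k, ∑ l, ∑ k', ∑ l', u k * v l * (u k' * v l') * f k l' k' l := by
    refine Finset.sum_congr rfl fun k _ => ?_
    rw [Finset.sum_comm]
    conv_rhs => rw [Finset.sum_comm]
    refine Finset.sum_congr rfl fun k' _ => ?_
    rw [Finset.sum_comm]
    exact Finset.sum_congr rfl fun l _ => Finset.sum_congr rfl fun l' _ => by ring
  have add (f f' : κ → κ → κ → κ → ℝ) :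
      ∑ k, ∑ l, ∑ k', ∑ l', u k * v l * (u k' * v l') * (f k l k' l' + f' k l k' l') =
      ∑ k, ∑ l, ∑ k', ∑ l', u k * v l * (u k' * v l') * f k l k' l' +
      ∑ k, ∑ l, ∑ k', ∑ l', u k * v l * (u k' * v l') * f' k l k' l' := by
    simp only [mul_add, Finset.sum_add_distrib]
  have sub (f f' : κ → κ → κ → κ → ℝ) :
      ∑ k, ∑ l, ∑ k', ∑ l', u k * v l * (u k' * v l') * (f k l k' l' - f' k l k' l') =
      ∑ k, ∑ l, ∑ k', ∑ l', u k * v l * (u k' * v l') * f k l k' l' -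
      ∑ k, ∑ l, ∑ k', ∑ l', u k * v l * (u k' * v l') * f' k l k' l' := by
    simp only [mul_sub, Finset.sum_sub_distrib]
  have nonneg : 0 ≤ ∑ k, ∑ l, ∑ k', ∑ l', u k * v l * (u k' * v l') *
      ((g k k + g k' k' - 2 * g k k') / 2 + (g l l + g l' l' - 2 * g l l') / 2) :=
    Finset.sum_nonneg fun k _ => Finset.sum_nonneg fun l _ => Finset.sum_nonneg fun k' _ =>
      Finset.sum_nonneg fun l' _ => mul_nonneg
        (mul_nonneg (mul_nonneg (hu k) (hv l)) (mul_nonneg (hu k') (hv l')))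
        (by linarith [hg k k', hg l l'])
  have z1 := sub (fun k _ _ _ => g k k / 2) (fun _ _ k' _ => g k' k' / 2)
  have s1 := swap_fst (fun k _ _ _ => g k k / 2)
  have z2 := sub (fun _ l _ _ => g l l / 2) (fun _ _ _ l' => g l' l' / 2)
  have s2 := swap_snd (fun _ l _ _ => g l l / 2)
  have z3 := sub (fun k _ _ l' => g k l') (fun k l _ _ => g k l)
  have s3 := swap_snd (fun k l _ _ => g k l)
  have z4 := sub (fun _ l k' _ => g k' l) (fun k l _ _ => g k l)
  have s4 := swap_fst (fun k l _ _ => g k l)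
  have e := add (fun k l k' l' => (g k k + g k' k' - 2 * g k k') / 2 +
      (g l l + g l' l' - 2 * g l l') / 2) (fun k l k' l' => (g k k / 2 - g k' k' / 2) +
      ((g l l / 2 - g l' l' / 2) + ((g k l' - g k l) + (g k' l - g k l))))
  have e' := add (fun k l k' l' => g k k / 2 - g k' k' / 2) (fun k l k' l' =>
      (g l l / 2 - g l' l' / 2) + ((g k l' - g k l) + (g k' l - g k l)))
  have e'' := add (fun k l k' l' => g l l / 2 - g l' l' / 2) (fun k l k' l' =>
      (g k l' - g k l) + (g k' l - g k l))
  have e''' := add (fun k l k' l' => g k l' - g k l) (fun k l k' l' => g k' l - g k l)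
  have f := sub (fun k l k' l' => g k k + g l l - 2 * g k l)
    (fun k l k' l' => g k k' - g k l' - g l k' + g l l')
  -- The difference of the two integrands is half the increments of g over (k, k') and (l, l'),
  -- which are nonnegative, plus terms that average to zero by the two swaps.
  have c : ∑ k, ∑ l, ∑ k', ∑ l', u k * v l * (u k' * v l') *
      ((g k k + g l l - 2 * g k l) - (g k k' - g k l' - g l k' + g l l')) =
      ∑ k, ∑ l, ∑ k', ∑ l', u k * v l * (u k' * v l') *
      (((g k k + g k' k' - 2 * g k k') / 2 +
      (g l l + g l' l' - 2 * g l l') / 2) + ((g k k / 2 - g k' k' / 2) +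
      ((g l l / 2 - g l' l' / 2) + ((g k l' - g k l) + (g k' l - g k l))))) :=
    Finset.sum_congr rfl fun k _ => Finset.sum_congr rfl fun l _ =>
      Finset.sum_congr rfl fun k' _ => Finset.sum_congr rfl fun l' _ => by
        rw [hsymm l k']; ring
  linarith

theorem sum_pair_kernel_le_sum_mul_sum (u v : κ → ℝ) (g : κ → κ → ℝ) (hu : ∀ k, 0 ≤ u k)
    (hv : ∀ k, 0 ≤ v k) (hsymm : ∀ k l, g k l = g l k)
    (hg : ∀ k l, 0 ≤ g k k + g l l - 2 * g k l) :
    ∑ p : κ × κ, ∑ q : κ × κ, u p.1 * v p.2 * (u q.1 * v q.2) *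
        (g p.1 q.1 - g p.1 q.2 - g p.2 q.1 + g p.2 q.2) ≤
      (∑ q : κ × κ, u q.1 * v q.2) *
        ∑ p : κ × κ, u p.1 * v p.2 * (g p.1 p.1 + g p.2 p.2 - 2 * g p.1 p.2) := by
  have h := sum_pair_kernel_le u v g hu hv hsymm hg
  rw [mul_comm, Finset.sum_mul]
  simp only [Finset.mul_sum, Fintype.sum_prod_type]
  refine h.trans_eq ?_
  exact Finset.sum_congr rfl fun k _ => Finset.sum_congr rfl fun l _ =>
      Finset.sum_congr rfl fun k' _ => Finset.sum_congr rfl fun l' _ => by ring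

/-- Comparison of the expectations of a smoothed version of
`β (max_{k, l} (x_k - x_l) - b / β)⁺`, for `x = A ξ` and `x = B ξ`. -/
theorem integral_logSumExp_diff_le {m : ℕ} (A B : κ → Fin m → ℝ)
    (horth : ∀ p q, ∑ k, A p k * B q k = 0)
    (hle : ∀ p q, ∑ k, (A p k - A q k) ^ 2 ≤ ∑ k, (B p k - B q k) ^ 2) (β b : ℝ) :
    ∫ ξ, logSumExp (fun o : Option (κ × κ) => o.elim 0 fun p =>
        β * (∑ k, A p.1 k * ξ k - ∑ k, A p.2 k * ξ k) - b) ∂stdGaussianPi m ≤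
      ∫ ξ, logSumExp (fun o : Option (κ × κ) => o.elim 0 fun p =>
        β * (∑ k, B p.1 k * ξ k - ∑ k, B p.2 k * ξ k) - b) ∂stdGaussianPi m := by
  -- The index `none` carries a zero row and zero shift: it is the constant entry 0 that produces
  -- the positive part.
  let D : (κ → Fin m → ℝ) → Option (κ × κ) → Fin m → ℝ :=
    fun A o k => o.elim 0 fun p => β * (A p.1 k - A p.2 k)
  let c : Option (κ × κ) → ℝ := fun o => o.elim 0 fun _ => -b
  have hD (A : κ → Fin m → ℝ) (ξ : Fin m → ℝ) : (fun o : Option (κ × κ) => o.elim 0 fun p =>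
      β * (∑ k, A p.1 k * ξ k - ∑ k, A p.2 k * ξ k) - b) =
      fun o => ∑ k, D A o k * ξ k + c o := by
    ext o
    cases o with
    | none => simp [D, c]
    | some p =>
      simp only [D, c, Option.elim]
      rw [← Finset.sum_sub_distrib, Finset.mul_sum, ← sub_eq_add_neg]
      congr 1
      exact Finset.sum_congr rfl fun k _ => by ring
  simp only [hD]
  refine integral_logSumExp_le (D A) (D B) c (fun o o' => ?_) fun s t ξ w hw => ?_
  · cases o with
    | none => simp [D]
    | some p =>
      cases o' with
      | none => simp [D]
      | some q =>
        simp only [D, Option.elim]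
        calc _ = β ^ 2 * (∑ k, A p.1 k * B q.1 k - ∑ k, A p.1 k * B q.2 k
              - ∑ k, A p.2 k * B q.1 k + ∑ k, A p.2 k * B q.2 k) := by
              simp only [Finset.mul_sum, ← Finset.sum_add_distrib, ← Finset.sum_sub_distrib]
              exact Finset.sum_congr rfl fun k _ => by ring
          _ = 0 := by simp [horth]
  · let g : κ → κ → ℝ := fun p q => ∑ k, (B p k * B q k - A p k * A q k)
    have hsymm (p q : κ) : g p q = g q p := Finset.sum_congr rfl fun k _ => by ring
    have hg (p q : κ) : 0 ≤ g p p + g q q - 2 * g p q := by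
      have : g p p + g q q - 2 * g p q =
          ∑ k, (B p k - B q k) ^ 2 - ∑ k, (A p k - A q k) ^ 2 := by
        simp only [g, Finset.mul_sum, ← Finset.sum_add_distrib, ← Finset.sum_sub_distrib]
        exact Finset.sum_congr rfl fun k _ => by ring
      rw [this]
      exact sub_nonneg.2 (hle p q)
    have hgram (p q : κ × κ) : ∑ k, (D B (some p) k * D B (some q) k -
        D A (some p) k * D A (some q) k) =
        β ^ 2 * (g p.1 q.1 - g p.1 q.2 - g p.2 q.1 + g p.2 q.2) := by
      simp only [g, D, Option.elim, Finset.mul_sum, ← Finset.sum_add_distrib,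
        ← Finset.sum_sub_distrib]
      exact Finset.sum_congr rfl fun k _ => by ring
    have hdiag (p : κ × κ) : g p.1 p.1 - g p.1 p.2 - g p.2 p.1 + g p.2 p.2 =
        g p.1 p.1 + g p.2 p.2 - 2 * g p.1 p.2 := by rw [hsymm p.2 p.1]; ring
    have hn (k : Fin m) (E : κ → Fin m → ℝ) : D E none k = 0 := rfl
    -- The exponential of a difference factors over k and l; the normalization and the shift -b are
    -- absorbed into u.
    obtain ⟨u, v, hu, hv, huv⟩ : ∃ u v : κ → ℝ, (∀ k, 0 ≤ u k) ∧ (∀ k, 0 ≤ v k) ∧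
        ∀ p : κ × κ, w (some p) = u p.1 * v p.2 := by
      set S := ∑ o, Real.exp (∑ k, (s * D A o k + t * D B o k) * ξ k + c o) with hS
      have hS0 : 0 < S := sum_exp_pos _
      refine ⟨fun i => Real.exp (∑ k, β * (s * A i k + t * B i k) * ξ k - b) / S,
        fun i => Real.exp (-∑ k, β * (s * A i k + t * B i k) * ξ k),
        fun k => by positivity, fun k => by positivity, fun p => ?_⟩
      rw [hw, softmax, ← hS, div_mul_eq_mul_div, ← Real.exp_add]
      congr 2
      simp only [D, c, Option.elim]
      have : ∑ k, (s * (β * (A p.1 k - A p.2 k)) + t * (β * (B p.1 k - B p.2 k))) * ξ k =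
          ∑ k, β * (s * A p.1 k + t * B p.1 k) * ξ k -
          ∑ k, β * (s * A p.2 k + t * B p.2 k) * ξ k := by
        rw [← Finset.sum_sub_distrib]
        exact Finset.sum_congr rfl fun k _ => by ring
      rw [this]; ring
    -- The pair weights have total mass 1 minus the weight of `none`; the deficit only helps, since
    -- the diagonal term is nonnegative.
    have hsum : ∑ q : κ × κ, u q.1 * v q.2 ≤ 1 := by
      have h1 : ∑ o, w o = 1 := by rw [hw]; exact sum_softmax _
      have h0 : 0 ≤ w none := by rw [hw]; exact softmax_nonneg _ _
      rw [Fintype.sum_option] at h1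
      simp only [huv] at h1
      linarith
    have key := sum_pair_kernel_le_sum_mul_sum u v g hu hv hsymm hg
    have hpos : 0 ≤ ∑ p : κ × κ, u p.1 * v p.2 * (g p.1 p.1 + g p.2 p.2 - 2 * g p.1 p.2) :=
      Finset.sum_nonneg fun p _ => mul_nonneg (mul_nonneg (hu _) (hv _)) (hg _ _)
    have key' := key.trans (mul_le_of_le_one_left hpos hsum)
    simp only [Fintype.sum_option, hn, hgram, hdiag, huv, mul_zero, zero_mul, sub_zero,
      Finset.sum_const_zero, zero_add]
    have := mul_nonneg (sq_nonneg β) (sub_nonneg.2 key')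
    rw [mul_sub, Finset.mul_sum, Finset.mul_sum] at this
    refine this.trans_eq ?_
    congr 1
    · exact Finset.sum_congr rfl fun p _ => by ring
    · refine Finset.sum_congr rfl fun p _ => ?_
      rw [Finset.mul_sum]
      exact Finset.sum_congr rfl fun q _ => by ring

end Quadruple

/-! ### Gaussian vectors: laws and linear representation -/

section Law

variable {Ω Ω' : Type*} [MeasurableSpace Ω] [MeasurableSpace Ω'] {P : Measure Ω} {P' : Measure Ω'}
  {κ : Type*} [Fintype κ]

omit [Fintype κ] in
theorem ProbabilityTheory.HasGaussianLaw.memLp_two_eval {X : κ → Ω → ℝ} (hX : HasGaussianLaw (fun ω i => X i ω) P)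
    (i : κ) : MemLp (X i) 2 P := (hX.eval i).memLp_two

theorem exists_strongDual_pi_eq (L : StrongDual ℝ (κ → ℝ)) :
    ∃ a : κ → ℝ, ∀ x, L x = ∑ i, a i * x i := by
  classical
  refine ⟨fun i => L (Pi.single i 1), fun x => ?_⟩
  conv_lhs => rw [pi_eq_sum_univ' x, map_sum]
  refine Finset.sum_congr rfl fun i _ => ?_
  rw [map_smul, smul_eq_mul, mul_comm]

theorem variance_sum_mul [IsProbabilityMeasure P] {X : κ → Ω → ℝ} (hX : ∀ i, MemLp (X i) 2 P)
    (a : κ → ℝ) :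
    Var[fun ω => ∑ i, a i * X i ω; P] = ∑ i, ∑ j, a i * a j * cov[X i, X j; P] := by
  rw [variance_fun_sum fun i => (hX i).const_mul (a i)]
  refine Finset.sum_congr rfl fun i _ => Finset.sum_congr rfl fun j _ => ?_
  rw [covariance_const_mul_left, covariance_const_mul_right]
  ring

/-- Two centered Gaussian vectors with the same covariances have the same law. -/
theorem ProbabilityTheory.HasGaussianLaw.map_eq_of_covariance_eq {X : κ → Ω → ℝ} {Y : κ → Ω' → ℝ}
    (hX : HasGaussianLaw (fun ω i => X i ω) P) (hY : HasGaussianLaw (fun ω i => Y i ω) P')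
    (hX0 : ∀ i, ∫ ω, X i ω ∂P = 0) (hY0 : ∀ i, ∫ ω, Y i ω ∂P' = 0)
    (hcov : ∀ i j, cov[X i, X j; P] = cov[Y i, Y j; P']) :
    P.map (fun ω i => X i ω) = P'.map (fun ω i => Y i ω) := by
  classical
  have := hX.isProbabilityMeasure
  have := hY.isProbabilityMeasure
  have := hX.isGaussian_map
  have := hY.isGaussian_map
  apply Measure.ext_of_charFunDual
  ext L
  rw [hX.charFunDual_map_eq_fun, hY.charFunDual_map_eq_fun]
  obtain ⟨a, ha⟩ := exists_strongDual_pi_eq L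
  simp only [ha]
  rw [variance_sum_mul hX.memLp_two_eval, variance_sum_mul hY.memLp_two_eval,
    integral_finsetSum _ fun i _ => (hX.eval i).integrable.const_mul _,
    integral_finsetSum _ fun i _ => (hY.eval i).integrable.const_mul _]
  simp only [integral_const_mul, hX0, hY0, hcov]

theorem ProbabilityTheory.HasGaussianLaw.posSemidef_covariance {X : κ → Ω → ℝ}
    (hX : HasGaussianLaw (fun ω i => X i ω) P) :
    (Matrix.of fun i j => cov[X i, X j; P]).PosSemidef := by
  have := hX.isProbabilityMeasure
  refine Matrix.PosSemidef.of_dotProduct_mulVec_nonneg ?_ fun x => ?_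
  · ext i j
    simp [covariance_comm]
  · have : star x ⬝ᵥ (Matrix.of fun i j => cov[X i, X j; P]).mulVec x =
        Var[fun ω => ∑ i, x i * X i ω; P] := by
      rw [variance_sum_mul hX.memLp_two_eval]
      simp only [dotProduct, Matrix.mulVec, Matrix.of_apply, Finset.mul_sum, star_trivial]
      exact Finset.sum_congr rfl fun i _ => Finset.sum_congr rfl fun j _ => by ring
    rw [this]
    exact variance_nonneg _ _

theorem hasGaussianLaw_stdGaussianPi (m : ℕ) :
    HasGaussianLaw (fun ξ : Fin m → ℝ => fun k => ξ k) (stdGaussianPi m) := by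
  refine iIndepFun.hasGaussianLaw (X := fun (k : Fin m) (ξ : Fin m → ℝ) => ξ k) (fun k => ?_) ?_
  · constructor
    rw [(measurePreserving_eval (fun _ : Fin m => gaussianReal 0 1) k).map_eq]
    infer_instance
  · exact iIndepFun_pi (X := fun _ x => x) fun _ => aemeasurable_id

theorem covariance_eval_stdGaussianPi {m : ℕ} (k l : Fin m) :
    cov[fun ξ => ξ k, fun ξ => ξ l; stdGaussianPi m] = if k = l then 1 else 0 := by
  split_ifs with h
  · subst h
    rw [covariance_self (measurable_pi_apply k).aemeasurable]
    have := (measurePreserving_eval (fun _ : Fin m => gaussianReal 0 1) k)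
    have h2 := this.map_eq ▸ variance_id_gaussianReal (μ := 0) (v := 1)
    rw [variance_map aemeasurable_id this.aemeasurable] at h2
    simpa using! h2
  · have hi : iIndepFun (fun (k : Fin m) (ξ : Fin m → ℝ) => ξ k) (stdGaussianPi m) :=
      iIndepFun_pi (X := fun _ x => x) fun _ => aemeasurable_id
    exact (hi.indepFun h).covariance_eq_zero
      ((hasGaussianLaw_stdGaussianPi m).memLp_two_eval k)
      ((hasGaussianLaw_stdGaussianPi m).memLp_two_eval l)

theorem hasGaussianLaw_linear {m : ℕ} (A : κ → Fin m → ℝ) :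
    HasGaussianLaw (fun (ξ : Fin m → ℝ) i => ∑ k, A i k * ξ k) (stdGaussianPi m) := by
  let Λ : (Fin m → ℝ) →L[ℝ] (κ → ℝ) :=
    ContinuousLinearMap.pi fun i => ∑ k, A i k • ContinuousLinearMap.proj k
  convert! (hasGaussianLaw_stdGaussianPi m).map_fun Λ using 2
  ext i
  simp [Λ]

omit [Fintype κ] in
theorem covariance_linear {m : ℕ} (A : κ → Fin m → ℝ) (i j : κ) :
    cov[fun ξ => ∑ k, A i k * ξ k, fun ξ => ∑ k, A j k * ξ k; stdGaussianPi m] =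
      ∑ k, A i k * A j k := by
  have h2 (k : Fin m) : MemLp (fun ξ : Fin m → ℝ => ξ k) 2 (stdGaussianPi m) :=
    (hasGaussianLaw_stdGaussianPi m).memLp_two_eval k
  rw [covariance_fun_sum_fun_sum (fun k => (h2 k).const_mul _) (fun k => (h2 k).const_mul _)]
  simp only [covariance_const_mul_left, covariance_const_mul_right, covariance_eval_stdGaussianPi]
  simp [mul_comm]

theorem integral_linear_stdGaussianPi {m : ℕ} (a : Fin m → ℝ) :
    ∫ ξ, ∑ k, a k * ξ k ∂stdGaussianPi m = 0 := by
  rw [integral_finsetSum _ fun k _ => (integrable_eval_stdGaussianPi k).const_mul _]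
  refine Finset.sum_eq_zero fun k _ => ?_
  rw [integral_const_mul]
  have := (measurePreserving_eval (fun _ : Fin m => gaussianReal 0 1) k)
  have h2 := this.map_eq ▸ integral_id_gaussianReal (μ := 0) (v := 1)
  rw [integral_map (measurable_pi_apply k).aemeasurable (by fun_prop)] at h2
  have h3 : ∫ ξ : Fin m → ℝ, ξ k ∂stdGaussianPi m = 0 := h2
  rw [h3, mul_zero]

theorem ProbabilityTheory.HasGaussianLaw.map_eq_map_linear {X : κ → Ω → ℝ}
    (hX : HasGaussianLaw (fun ω i => X i ω) P) (hX0 : ∀ i, ∫ ω, X i ω ∂P = 0) {m : ℕ}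
    {A : κ → Fin m → ℝ} (hA : ∀ i j, ∑ k, A i k * A j k = cov[X i, X j; P]) :
    P.map (fun ω i => X i ω) =
      (stdGaussianPi m).map (fun (ξ : Fin m → ℝ) i => ∑ k, A i k * ξ k) :=
  HasGaussianLaw.map_eq_of_covariance_eq hX
    (Y := fun i (ξ : Fin m → ℝ) => ∑ k, A i k * ξ k) (hasGaussianLaw_linear A) hX0
    (fun i => integral_linear_stdGaussianPi (A i)) fun i j => by rw [covariance_linear, hA]

/-- A covariance matrix is positive semidefinite, hence a sum of rank-one matrices v vᵀ; the vectors
v are the columns of A. -/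
theorem ProbabilityTheory.HasGaussianLaw.exists_covariance_eq_sum {X : κ → Ω → ℝ}
    (hX : HasGaussianLaw (fun ω i => X i ω) P) :
    ∃ (m : ℕ) (A : κ → Fin m → ℝ), ∀ i j, ∑ k, A i k * A j k = cov[X i, X j; P] := by
  obtain ⟨m, v, hv⟩ := Matrix.posSemidef_iff_eq_sum_vecMulVec.1 hX.posSemidef_covariance
  refine ⟨m, fun i k => v k i, fun i j => ?_⟩
  have := congrFun (congrFun hv i) j
  simp only [Matrix.of_apply, Matrix.sum_apply, Matrix.vecMulVec_apply, star_trivial] at this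
  exact this.symm

/-- Centered Gaussian vectors on two probability spaces can be represented on a common space, as
linear images of independent standard Gaussian vectors. -/
theorem ProbabilityTheory.HasGaussianLaw.exists_orthogonal_coupling {X : κ → Ω → ℝ} {Y : κ → Ω' → ℝ}
    (hX : HasGaussianLaw (fun ω i => X i ω) P) (hY : HasGaussianLaw (fun ω i => Y i ω) P') :
    ∃ (m : ℕ) (A B : κ → Fin m → ℝ), (∀ i j, ∑ k, A i k * B j k = 0) ∧
      (∀ i j, ∑ k, A i k * A j k = cov[X i, X j; P]) ∧
      (∀ i j, ∑ k, B i k * B j k = cov[Y i, Y j; P']) := by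
  obtain ⟨m, A, hA⟩ := hX.exists_covariance_eq_sum
  obtain ⟨n, B, hB⟩ := hY.exists_covariance_eq_sum
  -- Disjoint coordinate blocks make the two representations independent.
  refine ⟨m + n, fun i => Fin.append (A i) 0, fun i => Fin.append 0 (B i), ?_, ?_, ?_⟩
  · simp [Fin.sum_univ_add]
  · simpa [Fin.sum_univ_add] using hA
  · simpa [Fin.sum_univ_add] using hB

/-- Smoothed Sudakov-Fernique comparison of the ranges of two Gaussian vectors. -/
theorem ProbabilityTheory.HasGaussianLaw.integral_logSumExp_diff_le {X : κ → Ω → ℝ} {Y : κ → Ω' → ℝ}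
    (hX : HasGaussianLaw (fun ω i => X i ω) P) (hY : HasGaussianLaw (fun ω i => Y i ω) P')
    (hX0 : ∀ i, ∫ ω, X i ω ∂P = 0) (hY0 : ∀ i, ∫ ω, Y i ω ∂P' = 0)
    (hle : ∀ i j, cov[X i, X i; P] + cov[X j, X j; P] - 2 * cov[X i, X j; P] ≤
      cov[Y i, Y i; P'] + cov[Y j, Y j; P'] - 2 * cov[Y i, Y j; P']) (β b : ℝ) :
    ∫ ω, logSumExp (fun o : Option (κ × κ) => o.elim 0 fun p =>
        β * (X p.1 ω - X p.2 ω) - b) ∂P ≤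
      ∫ ω, logSumExp (fun o : Option (κ × κ) => o.elim 0 fun p =>
        β * (Y p.1 ω - Y p.2 ω) - b) ∂P' := by
  obtain ⟨m, A, B, hAB, hA, hB⟩ := HasGaussianLaw.exists_orthogonal_coupling hX hY
  have hc : Continuous fun x : κ → ℝ => logSumExp (fun o : Option (κ × κ) => o.elim 0 fun p =>
        β * (x p.1 - x p.2) - b) := by
    refine continuous_logSumExp.comp (continuous_pi fun o => ?_)
    cases o with
    | none => exact continuous_const
    | some p => simp only [Option.elim]; fun_prop
  have key := _root_.integral_logSumExp_diff_le A B hAB (fun i j => by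
    have e (A : κ → Fin m → ℝ) : ∑ k, (A i k - A j k) ^ 2 =
        ∑ k, A i k * A i k + ∑ k, A j k * A j k - 2 * ∑ k, A i k * A j k := by
      simp only [Finset.mul_sum, ← Finset.sum_add_distrib, ← Finset.sum_sub_distrib]
      exact Finset.sum_congr rfl fun k _ => by ring
    rw [e A, e B]
    simp only [hA, hB]
    exact hle i j) β b
  have eX := integral_map (μ := P) hX.aemeasurable hc.aestronglyMeasurable
  have eY := integral_map (μ := P') hY.aemeasurable hc.aestronglyMeasurable
  rw [HasGaussianLaw.map_eq_map_linear hX hX0 hA,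
    integral_map (Measurable.aemeasurable (by fun_prop)) hc.aestronglyMeasurable] at eX
  rw [HasGaussianLaw.map_eq_map_linear hY hY0 hB,
    integral_map (Measurable.aemeasurable (by fun_prop)) hc.aestronglyMeasurable] at eY
  rw [← eX, ← eY]
  exact key

end Law

/-! ### Stop-loss comparison for finite vectors -/

section Range

variable {κ : Type*}

/-- The range `sup x - inf x` of a real function. -/
noncomputable def range (x : κ → ℝ) : ℝ := ⨆ p : κ × κ, (x p.1 - x p.2)

theorem range_nonneg (x : κ → ℝ) : 0 ≤ range x := by
  rcases isEmpty_or_nonempty κ with h | ⟨⟨k⟩⟩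
  · simp [range]
  by_cases hb : BddAbove (Set.range fun p : κ × κ => x p.1 - x p.2)
  · simpa using! le_ciSup hb (k, k)
  -- An unbounded real supremum is 0 by convention, so nonnegativity holds for every ω and not only
  -- on the continuous paths.
  · exact (Real.iSup_of_not_bddAbove hb).ge

theorem measurable_range [Countable κ] : Measurable (range : (κ → ℝ) → ℝ) :=
  Measurable.iSup fun _ => by fun_prop

theorem sub_le_range [Finite κ] (x : κ → ℝ) (p : κ × κ) : x p.1 - x p.2 ≤ range x :=
  le_ciSup (f := fun p : κ × κ => x p.1 - x p.2) (Set.finite_range _).bddAbove p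

variable [Fintype κ] {Ω Ω' : Type*} [MeasurableSpace Ω] [MeasurableSpace Ω'] {P : Measure Ω}
  {P' : Measure Ω'}

theorem range_le_sum (x : κ → ℝ) : range x ≤ 2 * ∑ i, |x i| := by
  have h0 : 0 ≤ 2 * ∑ i, |x i| := by positivity
  refine Real.iSup_le (fun p => ?_) h0
  have hle (p : κ) : |x p| ≤ ∑ p, |x p| :=
    Finset.single_le_sum (f := fun q => |x q|) (fun q _ => abs_nonneg _) (Finset.mem_univ p)
  linarith [hle p.1, hle p.2, le_abs_self (x p.1), neg_abs_le (x p.2)]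

theorem integrable_range {X : κ → Ω → ℝ} (hX : ∀ i, Integrable (X i) P) :
    Integrable (fun ω => range fun i => X i ω) P := by
  refine Integrable.mono' (g := fun ω => 2 * ∑ i, |X i ω|)
    ((integrable_finsetSum _ fun i _ => (hX i).abs).const_mul 2) ?_ (ae_of_all _ fun ω => ?_)
  · exact (measurable_range.comp_aemeasurable
      (aemeasurable_pi_lambda _ fun i => (hX i).aemeasurable)).aestronglyMeasurable
  · rw [Real.norm_of_nonneg (range_nonneg _)]
    exact range_le_sum _

theorem ProbabilityTheory.HasGaussianLaw.integral_posPart_range_sub_le {X : κ → Ω → ℝ}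
    {Y : κ → Ω' → ℝ}
    (hX : HasGaussianLaw (fun ω i => X i ω) P) (hY : HasGaussianLaw (fun ω i => Y i ω) P')
    (hX0 : ∀ i, ∫ ω, X i ω ∂P = 0) (hY0 : ∀ i, ∫ ω, Y i ω ∂P' = 0)
    (hle : ∀ i j, cov[X i, X i; P] + cov[X j, X j; P] - 2 * cov[X i, X j; P] ≤
      cov[Y i, Y i; P'] + cov[Y j, Y j; P'] - 2 * cov[Y i, Y j; P']) {a : ℝ} (ha : 0 ≤ a) :
    ∫ ω, max ((range fun i => X i ω) - a) 0 ∂P ≤ ∫ ω, max ((range fun i => Y i ω) - a) 0 ∂P' := by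
  have := hX.isProbabilityMeasure
  have := hY.isProbabilityMeasure
  -- F β exceeds β(range - a)⁺ by an amount between 0 and N, which does not depend on β.
  let F : ℝ → (κ → ℝ) → ℝ := fun β x => logSumExp (fun o : Option (κ × κ) => o.elim 0 fun p =>
        β * (x p.1 - x p.2) - β * a)
  let N : ℝ := Real.log (Fintype.card (Option (κ × κ)))
  have hN : 0 ≤ N := Real.log_natCast_nonneg _
  have hFc (β : ℝ) : Continuous (F β) := by
    refine continuous_logSumExp.comp (continuous_pi fun o => ?_)
    cases o with
    | none => exact continuous_const
    | some p => simp only [Option.elim]; fun_prop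
  have hF0 (β : ℝ) (x : κ → ℝ) : 0 ≤ F β x :=
    le_logSumExp (fun o : Option (κ × κ) => o.elim 0 fun p => β * (x p.1 - x p.2) - β * a) none
  have hlow {β : ℝ} (hβ : 0 < β) (x : κ → ℝ) : β * max (range x - a) 0 ≤ F β x := by
    rw [mul_max_of_nonneg _ _ hβ.le, mul_zero]
    refine max_le ?_ (hF0 β x)
    have : range x ≤ F β x / β + a := by
      -- The bound must itself be nonnegative, as the supremum over an empty κ is 0; this uses a ≥
      -- 0.
      refine Real.iSup_le (fun p => ?_) (by have := hF0 β x; positivity)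
      have h := le_logSumExp
        (fun o : Option (κ × κ) => o.elim 0 fun p => β * (x p.1 - x p.2) - β * a) (some p)
      have h' : β * (x p.1 - x p.2 - a) ≤ F β x := by rw [mul_sub]; exact h
      rw [mul_comm, ← le_div_iff₀ hβ] at h'
      linarith
    have : range x - a ≤ F β x / β := by linarith
    rw [le_div_iff₀ hβ] at this
    linarith
  have hup {β : ℝ} (hβ : 0 < β) (x : κ → ℝ) : F β x ≤ β * max (range x - a) 0 + N := by
    refine logSumExp_le fun o => ?_
    cases o with
    | none => exact mul_nonneg hβ.le (le_max_right _ _)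
    | some p =>
      simp only [Option.elim]
      rw [← mul_sub]
      refine mul_le_mul_of_nonneg_left (le_max_of_le_left ?_) hβ.le
      linarith [sub_le_range x p]
  have hcmp (β : ℝ) : ∫ ω, F β fun i => X i ω ∂P ≤ ∫ ω, F β fun i => Y i ω ∂P' :=
    hX.integral_logSumExp_diff_le hY hX0 hY0 hle β (β * a)
  clear_value F N
  have iX : Integrable (fun ω => max ((range fun i => X i ω) - a) 0) P :=
    ((integrable_range fun i => (hX.eval i).integrable).sub (integrable_const a)).pos_part
  have iY : Integrable (fun ω => max ((range fun i => Y i ω) - a) 0) P' :=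
    ((integrable_range fun i => (hY.eval i).integrable).sub (integrable_const a)).pos_part
  have iFX {β : ℝ} (hβ : 0 < β) : Integrable (fun ω => F β fun i => X i ω) P := by
    refine ((iX.const_mul β).add (integrable_const N)).mono' ?_ (ae_of_all _ fun ω => ?_)
    · exact ((hFc β).measurable.comp_aemeasurable hX.aemeasurable).aestronglyMeasurable
    · exact (Real.norm_of_nonneg (hF0 β fun i => X i ω)).trans_le (hup hβ _)
  have iFY {β : ℝ} (hβ : 0 < β) : Integrable (fun ω => F β fun i => Y i ω) P' := by
    refine ((iY.const_mul β).add (integrable_const N)).mono' ?_ (ae_of_all _ fun ω => ?_)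
    · exact ((hFc β).measurable.comp_aemeasurable hY.aemeasurable).aestronglyMeasurable
    · exact (Real.norm_of_nonneg (hF0 β fun i => Y i ω)).trans_le (hup hβ _)
  refine le_of_forall_pos_le_add fun ε hε => ?_
  -- Chosen so that the smoothing error N/β is at most ε.
  set β : ℝ := (N + 1) / ε with hβd
  have hβ : 0 < β := by positivity
  have key : β * ∫ ω, max ((range fun i => X i ω) - a) 0 ∂P ≤
      β * ∫ ω, max ((range fun i => Y i ω) - a) 0 ∂P' + N := by
    calc _ = ∫ ω, β * max ((range fun i => X i ω) - a) 0 ∂P := (integral_const_mul _ _).symm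
      _ ≤ ∫ ω, F β fun i => X i ω ∂P :=
        integral_mono (iX.const_mul β) (iFX hβ) fun ω => hlow hβ _
      _ ≤ ∫ ω, F β fun i => Y i ω ∂P' := hcmp β
      _ ≤ ∫ ω, (β * max ((range fun i => Y i ω) - a) 0 + N) ∂P' :=
        integral_mono (iFY hβ) ((iY.const_mul β).add (integrable_const N)) fun ω => hup hβ _
      _ = _ := by
        rw [integral_add (iY.const_mul β) (integrable_const N), integral_const_mul]
        simp
  have hβε : N ≤ β * ε := by rw [hβd]; field_simp; linarith
  have : β * ∫ ω, max ((range fun i => X i ω) - a) 0 ∂P ≤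
      β * (∫ ω, max ((range fun i => Y i ω) - a) 0 ∂P' + ε) := by linarith
  exact le_of_mul_le_mul_left this hβ

theorem ProbabilityTheory.HasGaussianLaw.lintegral_range_sub_le {X : κ → Ω → ℝ}
    {Y : κ → Ω' → ℝ}
    (hX : HasGaussianLaw (fun ω i => X i ω) P) (hY : HasGaussianLaw (fun ω i => Y i ω) P')
    (hX0 : ∀ i, ∫ ω, X i ω ∂P = 0) (hY0 : ∀ i, ∫ ω, Y i ω ∂P' = 0)
    (hle : ∀ i j, cov[X i, X i; P] + cov[X j, X j; P] - 2 * cov[X i, X j; P] ≤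
      cov[Y i, Y i; P'] + cov[Y j, Y j; P'] - 2 * cov[Y i, Y j; P']) {a : ℝ} (ha : 0 ≤ a) :
    ∫⁻ ω, ENNReal.ofReal ((range fun i => X i ω) - a) ∂P ≤
      ∫⁻ ω, ENNReal.ofReal ((range fun i => Y i ω) - a) ∂P' := by
  have := hX.isProbabilityMeasure
  have := hY.isProbabilityMeasure
  have e (r : ℝ) : ENNReal.ofReal r = ENNReal.ofReal (max r 0) := by
    rcases le_total r 0 with h | h
    · rw [max_eq_right h, ENNReal.ofReal_of_nonpos h, ENNReal.ofReal_zero]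
    · rw [max_eq_left h]
  have iX : Integrable (fun ω => max ((range fun i => X i ω) - a) 0) P :=
    ((integrable_range fun i => (hX.eval i).integrable).sub (integrable_const a)).pos_part
  have iY : Integrable (fun ω => max ((range fun i => Y i ω) - a) 0) P' :=
    ((integrable_range fun i => (hY.eval i).integrable).sub (integrable_const a)).pos_part
  have h := hX.integral_posPart_range_sub_le hY hX0 hY0 hle ha
  simp only [e (_ - _)]
  rw [← ofReal_integral_eq_lintegral_ofReal iX (ae_of_all _ fun _ => le_max_right _ _),
    ← ofReal_integral_eq_lintegral_ofReal iY (ae_of_all _ fun _ => le_max_right _ _)]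
  exact ENNReal.ofReal_le_ofReal h

end Range

/-! ### From stop-loss order to increasing convex order -/

section ConvexOrder

/-- Difference quotients of `g` on the grid `h ℕ`, shifted by one step and extended by `0`. -/
noncomputable def gridSlope (g : ℝ → ℝ) (h : ℝ) : ℕ → ℝ
  | 0 => 0
  | j + 1 => (g ((j + 1) * h) - g (j * h)) / h

variable {g : ℝ → ℝ} {h : ℝ}

theorem gridSlope_succ_mul (hh : 0 < h) (j : ℕ) :
    gridSlope g h (j + 1) * h = g ((j + 1) * h) - g (j * h) :=
  div_mul_cancel₀ _ hh.ne'

theorem gridSlope_nonneg (hg : Monotone g) (hh : 0 < h) (j : ℕ) : 0 ≤ gridSlope g h j := by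
  cases j with
  | zero => exact le_rfl
  | succ j => exact div_nonneg (sub_nonneg.2 (hg (by nlinarith))) hh.le

/-- Convexity orders successive slopes, and monotonicity covers the first step up from 0. Hence
`callMixture` has nonnegative weights. -/
theorem gridSlope_le_succ (hg : Monotone g) (hgc : ConvexOn ℝ Set.univ g) (hh : 0 < h) (j : ℕ) :
    gridSlope g h j ≤ gridSlope g h (j + 1) := by
  cases j with
  | zero => exact gridSlope_nonneg hg hh 1
  | succ j =>
    have := hgc.slope_mono_adjacent (x := j * h) (y := (j + 1) * h) (z := (j + 1 + 1) * h) trivial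
      trivial (by nlinarith) (by nlinarith)
    simp only [gridSlope]
    push_cast
    convert! this using 2 <;> ring

/-- Summation by parts. On the cell starting at (m + 1)h, the right side is the linear interpolant
of g(· - h) - g 0. -/
theorem sum_gridSlope (hh : 0 < h) (x : ℝ) (m : ℕ) :
    ∑ j ∈ Finset.range (m + 1), (gridSlope g h (j + 1) - gridSlope g h j) * (x - (j + 1) * h) =
      gridSlope g h (m + 1) * (x - (m + 1) * h) + (g (m * h) - g 0) := by
  induction m with
  | zero => simp [gridSlope]
  | succ m ih =>
    rw [Finset.sum_range_succ, ih]
    have := gridSlope_succ_mul (g := g) hh m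
    push_cast
    linarith

/-- A mixture of the functions `x ↦ (x - a)⁺` that approximates `g - g 0` from below. -/
noncomputable def callMixture (g : ℝ → ℝ) (h x : ℝ) : ENNReal :=
  ∑' j : ℕ, ENNReal.ofReal (gridSlope g h (j + 1) - gridSlope g h j) *
    ENNReal.ofReal (x - (j + 1) * h)

theorem callMixture_eq_sum (hg : Monotone g) (hgc : ConvexOn ℝ Set.univ g) (hh : 0 < h) {x : ℝ}
    {m : ℕ} (hm : m * h ≤ x) (hm' : x < (m + 1) * h) :
    callMixture g h x = ENNReal.ofReal (∑ j ∈ Finset.range m,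
      (gridSlope g h (j + 1) - gridSlope g h j) * (x - (j + 1) * h)) := by
  have hs (j : ℕ) := sub_nonneg.2 (gridSlope_le_succ hg hgc hh j)
  rw [callMixture, tsum_eq_sum (s := Finset.range m), ENNReal.ofReal_sum_of_nonneg]
  · exact Finset.sum_congr rfl fun j _ => (ENNReal.ofReal_mul (hs j)).symm
  · intro j hj
    have : ((j : ℝ) + 1) ≤ m := by exact_mod_cast Finset.mem_range.1 hj
    exact mul_nonneg (hs j) (by nlinarith)
  · intro j hj
    have : (m : ℝ) ≤ j := by exact_mod_cast not_lt.1 (fun h => hj (Finset.mem_range.2 h))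
    rw [ENNReal.ofReal_of_nonpos (p := x - (j + 1) * h) (by nlinarith), mul_zero]

theorem exists_grid (hh : 0 < h) {x : ℝ} (hx : 0 ≤ x) :
    ∃ m : ℕ, m * h ≤ x ∧ x < (m + 1) * h :=
  ⟨⌊x / h⌋₊, by rw [← le_div_iff₀ hh]; exact Nat.floor_le (by positivity), by
    rw [← div_lt_iff₀ hh]; exact Nat.lt_floor_add_one _⟩

/-- The one-step shift keeps the interpolant below g: on a cell it is at most its right-end value,
which is g at the left end minus g 0. -/
theorem callMixture_le (hg : Monotone g) (hgc : ConvexOn ℝ Set.univ g) (hh : 0 < h) {x : ℝ}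
    (hx : 0 ≤ x) : callMixture g h x ≤ ENNReal.ofReal (g x - g 0) := by
  obtain ⟨m, hm, hm'⟩ := exists_grid hh hx
  rw [callMixture_eq_sum hg hgc hh hm hm']
  apply ENNReal.ofReal_le_ofReal
  cases m with
  | zero => simpa using hg hx
  | succ m =>
    rw [sum_gridSlope hh]
    push_cast at hm hm'
    have h1 : gridSlope g h (m + 1) * (x - (m + 1) * h) ≤ gridSlope g h (m + 1) * h :=
      mul_le_mul_of_nonneg_left (by linarith) (gridSlope_nonneg hg hh _)
    rw [gridSlope_succ_mul hh] at h1
    linarith [hg hm]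

/-- A chord of a convex function lies above its graph, here for g(· - h). -/
theorem le_callMixture (hg : Monotone g) (hgc : ConvexOn ℝ Set.univ g) (hh : 0 < h) {x : ℝ}
    (hx : 0 ≤ x) : ENNReal.ofReal (g (x - h) - g 0) ≤ callMixture g h x := by
  obtain ⟨m, hm, hm'⟩ := exists_grid hh hx
  rw [callMixture_eq_sum hg hgc hh hm hm']
  apply ENNReal.ofReal_le_ofReal
  cases m with
  | zero =>
    have : g (x - h) ≤ g 0 := hg (by simp at hm'; linarith)
    simpa using this
  | succ m =>
    rw [sum_gridSlope hh]
    push_cast at hm hm'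
    set δ := (x - (m + 1) * h) / h with hδ
    have hδ0 : 0 ≤ δ := div_nonneg (by linarith) hh.le
    have hδ1 : δ ≤ 1 := by rw [hδ, div_le_one hh]; linarith
    have hδh : δ * h = x - (m + 1) * h := div_mul_cancel₀ _ hh.ne'
    have hc := hgc.2 (Set.mem_univ (m * h)) (Set.mem_univ ((m + 1) * h)) (sub_nonneg.2 hδ1) hδ0
      (by ring)
    simp only [smul_eq_mul] at hc
    have e : (1 - δ) * (m * h) + δ * ((m + 1) * h) = x - h := by linarith
    rw [e] at hc
    have h1 : gridSlope g h (m + 1) * (x - (m + 1) * h) = δ * (g ((m + 1) * h) - g (m * h)) := by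
      rw [← hδh, ← gridSlope_succ_mul hh]; ring
    rw [h1]
    linarith

variable {Ω Ω' : Type*} [MeasurableSpace Ω] [MeasurableSpace Ω'] {P : Measure Ω} {P' : Measure Ω'}

theorem lintegral_callMixture {R : Ω → ℝ} (hR : AEMeasurable R P) :
    ∫⁻ ω, callMixture g h (R ω) ∂P = ∑' j : ℕ, ENNReal.ofReal (gridSlope g h (j + 1) -
      gridSlope g h j) * ∫⁻ ω, ENNReal.ofReal (R ω - (j + 1) * h) ∂P := by
  unfold callMixture
  rw [lintegral_tsum fun j => by fun_prop]
  congr 1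
  ext j
  rw [lintegral_const_mul'' _ (by fun_prop)]

/-- The stop-loss order implies the increasing convex order. -/
theorem lintegral_convex_le {R : Ω → ℝ} {R' : Ω' → ℝ} (hR : AEMeasurable R P)
    (hR' : AEMeasurable R' P') (hR0 : ∀ ω, 0 ≤ R ω) (hR0' : ∀ ω, 0 ≤ R' ω)
    (hle : ∀ a, 0 ≤ a →
      ∫⁻ ω, ENNReal.ofReal (R ω - a) ∂P ≤ ∫⁻ ω, ENNReal.ofReal (R' ω - a) ∂P')
    (hg : Monotone g) (hgc : ConvexOn ℝ Set.univ g) :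
    ∫⁻ ω, ENNReal.ofReal (g (R ω) - g 0) ∂P ≤ ∫⁻ ω, ENNReal.ofReal (g (R' ω) - g 0) ∂P' := by
  have hcont : Continuous g := continuousOn_univ.1 (hgc.continuousOn isOpen_univ)
  have hstep {h : ℝ} (hh : 0 < h) : ∫⁻ ω, ENNReal.ofReal (g (R ω - h) - g 0) ∂P ≤
      ∫⁻ ω, ENNReal.ofReal (g (R' ω) - g 0) ∂P' :=
    calc _ ≤ ∫⁻ ω, callMixture g h (R ω) ∂P :=
          lintegral_mono fun ω => le_callMixture hg hgc hh (hR0 ω)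
      _ ≤ ∫⁻ ω, callMixture g h (R' ω) ∂P' := by
          rw [lintegral_callMixture hR, lintegral_callMixture hR']
          exact ENNReal.tsum_le_tsum fun j => mul_le_mul_right (hle _ (by positivity)) _
      _ ≤ _ := lintegral_mono fun ω => callMixture_le hg hgc hh (hR0' ω)
  -- The mesh h = 1/(n + 1) tends to 0; continuity of g and Fatou remove the shift, with no
  -- integrability required.
  calc _ = ∫⁻ ω, Filter.liminf (fun n : ℕ =>
        ENNReal.ofReal (g (R ω - 1 / ((n : ℝ) + 1)) - g 0)) Filter.atTop ∂P := by
        congr 1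
        ext ω
        refine (Filter.Tendsto.liminf_eq ?_).symm
        have h0 := (tendsto_one_div_add_atTop_nhds_zero_nat (𝕜 := ℝ)).const_sub (R ω)
        rw [sub_zero] at h0
        exact ENNReal.tendsto_ofReal (((hcont.tendsto _).comp h0).sub_const _)
    _ ≤ Filter.liminf (fun n : ℕ => ∫⁻ ω,
        ENNReal.ofReal (g (R ω - 1 / ((n : ℝ) + 1)) - g 0) ∂P) Filter.atTop :=
        lintegral_liminf_le' fun n => by fun_prop
    _ ≤ _ := Filter.liminf_le_of_le (by isBoundedDefault) fun b hb => by
        obtain ⟨n, hn⟩ := hb.exists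
        exact hn.trans (hstep (by positivity))

/-- A lower bound c makes the negative part integrable, so the expectation reduces to the integral
of the nonnegative f - c. -/
theorem extExpectation_eq_of_le [IsProbabilityMeasure P] {f : Ω → ℝ} (hf : AEMeasurable f P)
    {c : ℝ} (hc : ∀ ω, c ≤ f ω) :
    extExpectation P f = ((∫⁻ ω, ENNReal.ofReal (f ω - c) ∂P : ENNReal) : EReal) + (c : EReal) := by
  -- The identity f = (f - c) + c in positive and negative parts, arranged without subtraction so
  -- that it can be integrated in `ENNReal`.
  have hpt (ω : Ω) : ENNReal.ofReal (f ω) + ENNReal.ofReal (-c) =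
      ENNReal.ofReal (f ω - c) + (ENNReal.ofReal (-f ω) + ENNReal.ofReal c) := by
    have h := hc ω
    rcases le_total 0 (f ω) with h1 | h1 <;> rcases le_total 0 c with h2 | h2
    · rw [ENNReal.ofReal_of_nonpos (neg_nonpos.2 h1), ENNReal.ofReal_of_nonpos (neg_nonpos.2 h2),
        zero_add, add_zero, ← ENNReal.ofReal_add (by linarith) h2]
      congr 1; ring
    · rw [ENNReal.ofReal_of_nonpos (neg_nonpos.2 h1), ENNReal.ofReal_of_nonpos h2,
        add_zero, add_zero, ← ENNReal.ofReal_add (by linarith) (by linarith)]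
      congr 1
    · have h3 : f ω = 0 := by linarith
      have h4 : c = 0 := by linarith
      simp [h3, h4]
    · rw [ENNReal.ofReal_of_nonpos h1, ENNReal.ofReal_of_nonpos h2,
        zero_add, add_zero, ← ENNReal.ofReal_add (by linarith) (by linarith)]
      congr 1; ring
  have hint : ∫⁻ ω, ENNReal.ofReal (f ω) ∂P + ENNReal.ofReal (-c) =
      ∫⁻ ω, ENNReal.ofReal (f ω - c) ∂P +
        (∫⁻ ω, ENNReal.ofReal (-f ω) ∂P + ENNReal.ofReal c) := by
    have := lintegral_congr (μ := P) hpt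
    rw [lintegral_add_right' _ (by fun_prop), lintegral_add_left' (by fun_prop),
      lintegral_add_right' _ (by fun_prop)] at this
    simpa using this
  have hfin : ∫⁻ ω, ENNReal.ofReal (-f ω) ∂P ≠ ⊤ := by
    refine ((lintegral_mono (g := fun _ => ENNReal.ofReal (-c)) fun ω =>
      ENNReal.ofReal_le_ofReal (neg_le_neg (hc ω))).trans_lt ?_).ne
    simp
  rw [extExpectation]
  generalize (∫⁻ ω, ENNReal.ofReal (f ω) ∂P) = x at hint
  generalize (∫⁻ ω, ENNReal.ofReal (f ω - c) ∂P) = y at hint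
  generalize (∫⁻ ω, ENNReal.ofReal (-f ω) ∂P) = z at hint hfin
  lift z to NNReal using hfin
  have hcc : c = (ENNReal.ofReal c).toReal - (ENNReal.ofReal (-c)).toReal := by
    simp only [ENNReal.toReal_ofReal', max_zero_sub_max_neg_zero_eq_self]
  generalize ha : ENNReal.ofReal c = a at *
  generalize hb : ENNReal.ofReal (-c) = b at *
  have ha' : a ≠ ⊤ := by rw [← ha]; simp
  have hb' : b ≠ ⊤ := by rw [← hb]; simp
  lift a to NNReal using ha'
  lift b to NNReal using hb'
  induction x with
  | top =>
    have hy : y = ⊤ := by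
      by_contra hy
      lift y to NNReal using hy
      exact absurd hint.symm (by simp)
    subst hy
    simp
  | coe x =>
    have hy : y ≠ ⊤ := by
      rintro rfl
      simp at hint
    lift y to NNReal using hy
    have h1 : (x : ℝ) + b = y + (z + a) := by exact_mod_cast hint
    have h2 : (x : ℝ) - z = y + c := by
      rw [hcc]; simp only [ENNReal.coe_toReal]; linarith
    simp only [EReal.coe_nnreal_eq_coe_real]
    exact_mod_cast congrArg (Real.toEReal) h2

end ConvexOrder

/-! ### Suprema of continuous functions over dense sets -/

section Sup

open Filter Topology

variable {D : Type*} [TopologicalSpace D] [CompactSpace D]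

theorem bddAbove_range_of_compactSpace {F : D → ℝ} (hF : Continuous F) :
    BddAbove (Set.range F) :=
  (isCompact_range hF).bddAbove

omit [TopologicalSpace D] [CompactSpace D] in
theorem monotone_iSup_of_range_subset {J : ℕ → Type*} [∀ n, Finite (J n)] [∀ n, Nonempty (J n)]
    {v : ∀ n, J n → D} (hv : ∀ n j, ∃ j', v (n + 1) j' = v n j) (F : D → ℝ) :
    Monotone fun n => ⨆ j, F (v n j) := by
  refine monotone_nat_of_le_succ fun n => ciSup_le fun j => ?_
  obtain ⟨j', hj'⟩ := hv n j
  rw [← hj']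
  exact le_ciSup (f := fun j => F (v (n + 1) j)) (Set.finite_range _).bddAbove j'

/-- The supremum of a continuous function over a compact space is the limit of the suprema over
increasing finite sets with dense union. -/
theorem tendsto_iSup_of_dense {J : ℕ → Type*} [∀ n, Finite (J n)] [∀ n, Nonempty (J n)]
    {v : ∀ n, J n → D} (hv : ∀ n j, ∃ j', v (n + 1) j' = v n j)
    (hd : Dense {d | ∃ n j, v n j = d}) {F : D → ℝ} (hF : Continuous F) :
    Tendsto (fun n => ⨆ j, F (v n j)) atTop (𝓝 (⨆ d, F d)) := by
  have hb := bddAbove_range_of_compactSpace hF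
  refine tendsto_atTop_isLUB (monotone_iSup_of_range_subset hv F) ⟨?_, fun b hb' => ?_⟩
  · rintro _ ⟨n, rfl⟩
    exact ciSup_le fun j => le_ciSup hb (v n j)
  · have : Nonempty D := ⟨v 0 Classical.ofNonempty⟩
    have hc : IsClosed {d | F d ≤ b} := isClosed_le hF continuous_const
    refine ciSup_le fun d => ?_
    have hsub : {d | ∃ n j, v n j = d} ⊆ {d | F d ≤ b} := by
      rintro _ ⟨n, j, rfl⟩
      exact (le_ciSup (f := fun j => F (v n j)) (Set.finite_range _).bddAbove j).trans
        (hb' ⟨n, rfl⟩)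
    exact hc.closure_subset_iff.2 hsub (hd d)

end Sup

/-! ### Passage from finite sets to continuous paths -/

section GaussianPaths

open Filter Topology

variable {S : Type*} [TopologicalSpace S] [CompactSpace S] [TopologicalSpace.SeparableSpace S]
  [Nonempty S]

/-- The first `n + 1` points of a dense sequence. -/
noncomputable def densePoints (S : Type*) [TopologicalSpace S] [TopologicalSpace.SeparableSpace S]
    [Nonempty S] (n : ℕ) (i : Fin (n + 1)) : S := TopologicalSpace.denseSeq S i

omit [CompactSpace S] in
theorem densePoints_castSucc (n : ℕ) (i : Fin (n + 1)) :
    densePoints S (n + 1) i.castSucc = densePoints S n i := by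
  simp [densePoints]

omit [CompactSpace S] in
theorem dense_densePoints : Dense {d | ∃ n i, densePoints S n i = d} := by
  refine (TopologicalSpace.denseRange_denseSeq S).mono ?_
  rintro _ ⟨n, rfl⟩
  exact ⟨n, Fin.last n, by simp [densePoints]⟩

theorem tendsto_iSup_densePoints {f : S → ℝ} (hf : Continuous f) :
    Tendsto (fun n => ⨆ i, f (densePoints S n i)) atTop (𝓝 (⨆ t, f t)) :=
  tendsto_iSup_of_dense (fun n i => ⟨i.castSucc, densePoints_castSucc n i⟩) dense_densePoints hf

theorem tendsto_range_densePoints {f : S → ℝ} (hf : Continuous f) :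
    Tendsto (fun n => range fun i => f (densePoints S n i)) atTop (𝓝 (range f)) := by
  refine tendsto_iSup_of_dense (J := fun n => Fin (n + 1) × Fin (n + 1)) (D := S × S)
    (v := fun n p => (densePoints S n p.1, densePoints S n p.2)) (F := fun p => f p.1 - f p.2)
    (fun n p => ⟨(p.1.castSucc, p.2.castSucc), by simp [densePoints_castSucc]⟩) ?_ (by fun_prop)
  refine (dense_densePoints.prod dense_densePoints).mono ?_
  rintro ⟨_, _⟩ ⟨⟨n, i, rfl⟩, ⟨m, j, rfl⟩⟩
  -- Points from stages n and m both occur at stage n + m.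
  exact ⟨n + m, (⟨i, by omega⟩, ⟨j, by omega⟩), rfl⟩

omit [CompactSpace S] in
theorem monotone_range_densePoints (f : S → ℝ) :
    Monotone fun n => range fun i => f (densePoints S n i) := by
  refine monotone_nat_of_le_succ fun n => ciSup_le fun p => ?_
  have := sub_le_range (fun i => f (densePoints S (n + 1) i)) (p.1.castSucc, p.2.castSucc)
  simpa only [densePoints_castSucc] using this

variable {Ω Ω' : Type*} [MeasurableSpace Ω] [MeasurableSpace Ω'] {P : Measure Ω} {P' : Measure Ω'}

/-- A dense sequence may repeat points, so v need not be injective: the vector is a linear image of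
the one indexed by the image of v. -/
theorem ProbabilityTheory.IsGaussianProcess.hasGaussianLaw_comp {S : Type*} {X : S → Ω → ℝ}
    (hX : IsGaussianProcess X P) {κ : Type*} [Fintype κ] (v : κ → S) :
    HasGaussianLaw (fun ω i => X (v i) ω) P := by
  classical
  let Λ : (Finset.univ.image v → ℝ) →L[ℝ] (κ → ℝ) :=
    ContinuousLinearMap.pi fun i => ContinuousLinearMap.proj ⟨v i, by simp⟩
  exact (hX.hasGaussianLaw (Finset.univ.image v)).map_fun Λ

theorem aemeasurable_range_path {X : S → Ω → ℝ} (hX : ∀ t, AEMeasurable (X t) P)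
    (hc : ∀ᵐ ω ∂P, Continuous fun t => X t ω) :
    AEMeasurable (fun ω => range fun t => X t ω) P := by
  refine aemeasurable_of_tendsto_metrizable_ae atTop (f := fun (n : ℕ) ω =>
    range fun i => X (densePoints S n i) ω) (fun n => ?_) ?_
  · exact measurable_range.comp_aemeasurable (aemeasurable_pi_lambda _ fun i => hX _)
  · filter_upwards [hc] with ω hω using tendsto_range_densePoints hω

theorem aemeasurable_iSup_path {X : S → Ω → ℝ} (hX : ∀ t, AEMeasurable (X t) P)
    (hc : ∀ᵐ ω ∂P, Continuous fun t => X t ω) :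
    AEMeasurable (fun ω => ⨆ t, X t ω) P := by
  refine aemeasurable_of_tendsto_metrizable_ae atTop (f := fun (n : ℕ) ω =>
    ⨆ i, X (densePoints S n i) ω) (fun n => ?_) ?_
  · exact AEMeasurable.iSup fun i => hX _
  · filter_upwards [hc] with ω hω using tendsto_iSup_densePoints hω

theorem tendsto_lintegral_range {X : S → Ω → ℝ} (hX : ∀ t, AEMeasurable (X t) P)
    (hc : ∀ᵐ ω ∂P, Continuous fun t => X t ω) (a : ℝ) :
    Tendsto (fun n => ∫⁻ ω, ENNReal.ofReal ((range fun i => X (densePoints S n i) ω) - a) ∂P)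
      atTop (𝓝 (∫⁻ ω, ENNReal.ofReal ((range fun t => X t ω) - a) ∂P)) := by
  refine lintegral_tendsto_of_tendsto_of_monotone (fun n => ?_) (ae_of_all _ fun ω => ?_) ?_
  · have : AEMeasurable (fun ω => range fun i => X (densePoints S n i) ω) P :=
      measurable_range.comp_aemeasurable (aemeasurable_pi_lambda _ fun i => hX _)
    fun_prop
  · intro n m hnm
    exact ENNReal.ofReal_le_ofReal (sub_le_sub_right
      (monotone_range_densePoints (fun t => X t ω) hnm) a)
  · filter_upwards [hc] with ω hω
    exact ENNReal.tendsto_ofReal ((tendsto_range_densePoints hω).sub_const a)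

/-- Sudakov-Fernique comparison for the stop-loss transforms of the ranges of two continuous
Gaussian processes. -/
theorem lintegral_range_path_sub_le {X : S → Ω → ℝ} {Y : S → Ω' → ℝ}
    (hX : IsGaussianProcess X P) (hY : IsGaussianProcess Y P')
    (hX0 : ∀ t, ∫ ω, X t ω ∂P = 0) (hY0 : ∀ t, ∫ ω, Y t ω ∂P' = 0)
    (hXc : ∀ᵐ ω ∂P, Continuous fun t => X t ω) (hYc : ∀ᵐ ω ∂P', Continuous fun t => Y t ω)
    (hle : ∀ s t, cov[X s, X s; P] + cov[X t, X t; P] - 2 * cov[X s, X t; P] ≤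
      cov[Y s, Y s; P'] + cov[Y t, Y t; P'] - 2 * cov[Y s, Y t; P']) {a : ℝ} (ha : 0 ≤ a) :
    ∫⁻ ω, ENNReal.ofReal ((range fun t => X t ω) - a) ∂P ≤
      ∫⁻ ω, ENNReal.ofReal ((range fun t => Y t ω) - a) ∂P' :=
  le_of_tendsto_of_tendsto' (tendsto_lintegral_range hX.aemeasurable hXc a)
    (tendsto_lintegral_range hY.aemeasurable hYc a) fun n =>
      (hX.hasGaussianLaw_comp (densePoints S n)).lintegral_range_sub_le
        (hY.hasGaussianLaw_comp (densePoints S n)) (fun _ => hX0 _) (fun _ => hY0 _)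
        (fun _ _ => hle _ _) ha

end GaussianPaths

/-! ### Integrability of the supremum -/

section Fernique

open Filter Topology ProbabilityTheory.Fernique

variable {Ω Ω' : Type*} [MeasurableSpace Ω] [MeasurableSpace Ω'] {P : Measure Ω} {P' : Measure Ω'}

/-- The bound in Fernique's theorem for a measure giving mass at least `c` to a ball. -/
noncomputable def ferniqueBound (c : ENNReal) : ENNReal :=
  ENNReal.ofReal (Real.exp (logRatio c)) +
    ∑' n : ℕ, ENNReal.ofReal (Real.exp (-2⁻¹ * Real.log (c / (1 - c)).toReal * 2 ^ n))

theorem ferniqueBound_lt_top {c : ENNReal} (hc : 2⁻¹ < c) (hc1 : c < 1) :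
    ferniqueBound c < ⊤ := by
  have hc_top : c < ⊤ := hc1.trans ENNReal.one_lt_top
  have hsub_top : 1 - c < ⊤ := tsub_le_self.trans_lt ENNReal.one_lt_top
  have hlt : 1 - c < c := by
    refine ENNReal.sub_lt_of_lt_add hc1.le ?_
    rw [← two_mul]
    rwa [inv_eq_one_div, ENNReal.div_lt_iff (by simp) (by simp), mul_comm] at hc
  refine ENNReal.add_lt_top.2 ⟨ENNReal.ofReal_lt_top, Summable.tsum_ofReal_lt_top <|
    Real.summable_exp_nat_mul_of_ge ?_ fun i => mod_cast (Nat.lt_pow_self (by simp)).le⟩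
  refine mul_neg_of_neg_of_pos (by simp) (Real.log_pos ?_)
  simp only [ENNReal.toReal_div, one_lt_div_iff, ENNReal.toReal_pos_iff, tsub_pos_iff_lt, hc1,
    hsub_top, and_self, true_and]
  rw [ENNReal.toReal_lt_toReal hsub_top.ne hc_top.ne]
  exact .inl hlt

/-- The expected norm of a centered Gaussian vector is controlled by a quantile of the norm,
independently of the dimension. -/
theorem ProbabilityTheory.HasGaussianLaw.lintegral_norm_le {κ : Type*} [Fintype κ]
    {X : κ → Ω → ℝ} (hX : HasGaussianLaw (fun ω i => X i ω) P) (hX0 : ∀ i, ∫ ω, X i ω ∂P = 0)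
    {a : ℝ} {c : ENNReal} (ha : 0 < a) (hc : 2⁻¹ < c) (hc1 : c < 1)
    (hca : c ≤ P {ω | ∀ i, |X i ω| ≤ a}) :
    ∫⁻ ω, ‖fun i => X i ω‖ₑ ∂P ≤
      ENNReal.ofReal (1 / (logRatio c * a⁻¹ ^ 2)) + ferniqueBound c := by
  have := hX.isProbabilityMeasure
  have hG := hX.isGaussian_map
  set μ := P.map (fun ω i => X i ω) with hμ
  have hμ0 : ∫ x, id x ∂μ = 0 := by
    rw [hμ, integral_map hX.aemeasurable (by fun_prop)]
    ext i
    simp only [id]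
    rw [eval_integral fun i => (hX.eval i).integrable]
    exact hX0 i
  have hball : c ≤ μ {x | ‖x‖ ≤ a} := by
    rw [hμ, Measure.map_apply_of_aemeasurable hX.aemeasurable
      (measurableSet_le (by fun_prop) (by fun_prop))]
    refine hca.trans (measure_mono fun ω hω => ?_)
    exact (pi_norm_le_iff_of_nonneg ha.le).2 hω
  -- Fernique's argument uses only rotation invariance and the mass of one ball, so its bound is
  -- independent of the dimension.
  have key := lintegral_exp_mul_sq_norm_le_of_map_rotation_eq_self
    (IsGaussian.map_rotation_eq_self hμ0 _) hball hc
  set γ := logRatio c * a⁻¹ ^ 2 with hγ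
  have hγ0 : 0 < γ := mul_pos (logRatio_pos hc hc1) (by positivity)
  have hpt (x : κ → ℝ) : ‖x‖ₑ ≤ ENNReal.ofReal (1 / γ) +
      ENNReal.ofReal (Real.exp (γ * ‖x‖ ^ 2)) := by
    rw [← ofReal_norm, ← ENNReal.ofReal_add (by positivity) (by positivity)]
    apply ENNReal.ofReal_le_ofReal
    have h1 := Real.add_one_le_exp (γ * ‖x‖ ^ 2)
    have h2 : ‖x‖ ≤ 1 / γ + γ * ‖x‖ ^ 2 := by
      have : 0 ≤ 1 / γ + γ * ‖x‖ ^ 2 - ‖x‖ := by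
        have e : 1 / γ + γ * ‖x‖ ^ 2 - ‖x‖ = ((γ * ‖x‖ - 1 / 2) ^ 2 + 3 / 4) / γ := by
          field_simp; ring
        rw [e]; positivity
      linarith
    linarith
  calc _ = ∫⁻ x, ‖x‖ₑ ∂μ := (lintegral_map' (by fun_prop) hX.aemeasurable).symm
    _ ≤ ∫⁻ x, (ENNReal.ofReal (1 / γ) + ENNReal.ofReal (Real.exp (γ * ‖x‖ ^ 2))) ∂μ :=
      lintegral_mono hpt
    _ = ENNReal.ofReal (1 / γ) + ∫⁻ x, ENNReal.ofReal (Real.exp (γ * ‖x‖ ^ 2)) ∂μ := by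
      rw [lintegral_add_left (by fun_prop)]
      simp
    _ ≤ _ := by gcongr; exact key

variable {S : Type*} [TopologicalSpace S] [CompactSpace S] [TopologicalSpace.SeparableSpace S]
  [Nonempty S]

/-- The supremum norm of a continuous centered Gaussian process is integrable. -/
theorem integrable_iSup_abs_path {X : S → Ω → ℝ} (hX : IsGaussianProcess X P)
    (hX0 : ∀ t, ∫ ω, X t ω ∂P = 0) (hc : ∀ᵐ ω ∂P, Continuous fun t => X t ω) :
    Integrable (fun ω => ⨆ t, |X t ω|) P := by
  have := hX.isProbabilityMeasure
  -- Paths are almost surely bounded, so one level N serves all finite subsets at once; 3/4 stands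
  -- for any number strictly between 1/2 and 1.
  obtain ⟨N, hN⟩ : ∃ N : ℕ, (3 / 4 : ENNReal) < P {ω | ∀ t, |X t ω| ≤ N} := by
    have hmono : Monotone fun N : ℕ => {ω | ∀ t, |X t ω| ≤ N} := fun N M hNM ω hω t =>
      (hω t).trans (by exact_mod_cast hNM)
    have h1 : P (⋃ N : ℕ, {ω | ∀ t, |X t ω| ≤ N}) = 1 := by
      have : ∀ᵐ ω ∂P, ω ∈ ⋃ N : ℕ, {ω | ∀ t, |X t ω| ≤ N} := by
        filter_upwards [hc] with ω hω
        obtain ⟨b, hb⟩ := bddAbove_range_of_compactSpace hω.abs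
        obtain ⟨N, hN⟩ := exists_nat_ge b
        exact Set.mem_iUnion.2 ⟨N, fun t => (hb ⟨t, rfl⟩).trans hN⟩
      exact (measure_congr (eventuallyEq_univ.2 this)).trans measure_univ
    have ht := tendsto_measure_iUnion_atTop (μ := P) hmono
    rw [h1] at ht
    refine (ht.eventually_const_lt ?_).exists
    refine ENNReal.div_lt_of_lt_mul ?_
    norm_num
  set c : ENNReal := 3 / 4 with hcd
  have hc2 : 2⁻¹ < c := by
    rw [hcd, inv_eq_one_div, ENNReal.div_lt_iff (by simp) (by simp)]
    rw [← ENNReal.toReal_lt_toReal (by finiteness) (by finiteness)]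
    simp; norm_num
  have hc1 : c < 1 := by
    refine ENNReal.div_lt_of_lt_mul ?_
    norm_num
  have hmeas (n : ℕ) : AEMeasurable (fun ω => ⨆ i, |X (densePoints S n i) ω|) P :=
    AEMeasurable.iSup fun i => (hX.aemeasurable _).abs
  have hlim : ∀ᵐ ω ∂P, Tendsto (fun n => ⨆ i, |X (densePoints S n i) ω|) atTop
      (𝓝 (⨆ t, |X t ω|)) := by
    filter_upwards [hc] with ω hω using tendsto_iSup_densePoints hω.abs
  set K : ENNReal := ENNReal.ofReal (1 / (logRatio c * (N + 1 : ℝ)⁻¹ ^ 2)) + ferniqueBound c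
    with hK
  have hbound (n : ℕ) : ∫⁻ ω, ‖⨆ i, |X (densePoints S n i) ω|‖ₑ ∂P ≤ K := by
    refine le_trans (lintegral_mono fun ω => ?_) ((hX.hasGaussianLaw_comp
      (densePoints S n)).lintegral_norm_le (fun i => hX0 _) (a := N + 1) (by positivity) hc2 hc1
      (hN.le.trans (measure_mono fun ω hω i => (hω _).trans (by linarith))))
    rw [← ofReal_norm, ← ofReal_norm]
    apply ENNReal.ofReal_le_ofReal
    rw [Real.norm_of_nonneg (Real.iSup_nonneg fun i => abs_nonneg _)]
    exact ciSup_le fun i => norm_le_pi_norm (fun i => X (densePoints S n i) ω) i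
  refine ⟨aestronglyMeasurable_of_tendsto_ae _ (fun n => (hmeas n).aestronglyMeasurable) hlim, ?_⟩
  have hfatou : ∫⁻ ω, ‖⨆ t, |X t ω|‖ₑ ∂P ≤
      liminf (fun n => ∫⁻ ω, ‖⨆ i, |X (densePoints S n i) ω|‖ₑ ∂P) atTop := by
    refine le_trans (lintegral_mono_ae ?_) (lintegral_liminf_le' fun n => (hmeas n).enorm)
    filter_upwards [hlim] with ω hω using hω.enorm.liminf_eq.ge
  refine hfatou.trans_lt ?_
  refine lt_of_le_of_lt (b := K) (Filter.liminf_le_of_le (by isBoundedDefault) fun b hb => ?_)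
    (ENNReal.add_lt_top.2 ⟨ENNReal.ofReal_lt_top, ferniqueBound_lt_top hc2 hc1⟩)
  obtain ⟨n, hn⟩ := hb.exists
  exact hn.trans (hbound n)

omit [TopologicalSpace.SeparableSpace S] in
theorem abs_iSup_le_iSup_abs {f : S → ℝ} (hf : Continuous f) : |⨆ t, f t| ≤ ⨆ t, |f t| := by
  have hb := bddAbove_range_of_compactSpace hf
  have hb' := bddAbove_range_of_compactSpace hf.abs
  obtain ⟨t⟩ := ‹Nonempty S›
  have : Nonempty S := ⟨t⟩
  refine abs_le.2 ⟨?_, ciSup_mono hb' fun t => le_abs_self _⟩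
  linarith [neg_abs_le (f t), le_ciSup hb t, le_ciSup hb' t]

theorem integrable_iSup_path {X : S → Ω → ℝ} (hX : IsGaussianProcess X P)
    (hX0 : ∀ t, ∫ ω, X t ω ∂P = 0) (hc : ∀ᵐ ω ∂P, Continuous fun t => X t ω) :
    Integrable (fun ω => ⨆ t, X t ω) P := by
  refine (integrable_iSup_abs_path hX hX0 hc).mono'
    (aemeasurable_iSup_path hX.aemeasurable hc).aestronglyMeasurable ?_
  filter_upwards [hc] with ω hω using abs_iSup_le_iSup_abs hω

theorem tendsto_integral_iSup_densePoints {X : S → Ω → ℝ} (hX : IsGaussianProcess X P)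
    (hX0 : ∀ t, ∫ ω, X t ω ∂P = 0) (hc : ∀ᵐ ω ∂P, Continuous fun t => X t ω) :
    Tendsto (fun n => ∫ ω, ⨆ i, X (densePoints S n i) ω ∂P) atTop
      (𝓝 (∫ ω, ⨆ t, X t ω ∂P)) := by
  refine tendsto_integral_of_dominated_convergence (fun ω => ⨆ t, |X t ω|) (fun n => ?_)
    (integrable_iSup_abs_path hX hX0 hc) (fun n => ?_) ?_
  · exact (AEMeasurable.iSup fun i => hX.aemeasurable _).aestronglyMeasurable
  · filter_upwards [hc] with ω hω
    have hb' := bddAbove_range_of_compactSpace hω.abs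
    refine abs_le.2 ⟨?_, ciSup_le fun i => (le_abs_self _).trans (le_ciSup hb' _)⟩
    have h1 := le_ciSup (f := fun i => X (densePoints S n i) ω) (Set.finite_range _).bddAbove 0
    linarith [neg_abs_le (X (densePoints S n 0) ω), le_ciSup hb' (densePoints S n 0)]
  · filter_upwards [hc] with ω hω using tendsto_iSup_densePoints hω

end Fernique

/-! ### From the range to the maximum -/

section Maximum

variable {Ω Ω' : Type*} [MeasurableSpace Ω] [MeasurableSpace Ω'] {P : Measure Ω} {P' : Measure Ω'}
  {κ : Type*} [Fintype κ] [Nonempty κ]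

omit [Fintype κ] in
theorem range_eq_iSup_add_iSup_neg [Finite κ] (x : κ → ℝ) :
    range x = (⨆ i, x i) + ⨆ i, -x i := by
  have hb (y : κ → ℝ) : BddAbove (Set.range y) := (Set.finite_range y).bddAbove
  refine le_antisymm (ciSup_le fun p => ?_) ?_
  · rw [sub_eq_add_neg]
    exact add_le_add (le_ciSup (hb x) _) (le_ciSup (hb fun i => -x i) _)
  · obtain ⟨i, hi⟩ := exists_eq_ciSup_of_finite (f := x)
    obtain ⟨j, hj⟩ := exists_eq_ciSup_of_finite (f := fun i => -x i)
    rw [← hi, ← hj, ← sub_eq_add_neg]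
    exact sub_le_range x (i, j)

theorem integrable_iSup_of_fintype {X : κ → Ω → ℝ} (hX : ∀ i, Integrable (X i) P) :
    Integrable (fun ω => ⨆ i, X i ω) P := by
  refine Integrable.mono' (g := fun ω => ∑ i, |X i ω|)
    (integrable_finsetSum _ fun i _ => (hX i).abs)
    (AEMeasurable.iSup fun i => (hX i).aemeasurable).aestronglyMeasurable
    (ae_of_all _ fun ω => ?_)
  obtain ⟨i, hi⟩ := exists_eq_ciSup_of_finite (f := fun i => X i ω)
  rw [← hi]
  exact Finset.single_le_sum (f := fun i => |X i ω|) (fun q _ => abs_nonneg _) (Finset.mem_univ i)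

/-- A centered Gaussian vector has the law of its negative, so max X and max(-X) have equal
expectations. -/
theorem ProbabilityTheory.HasGaussianLaw.integral_range_eq {X : κ → Ω → ℝ}
    (hX : HasGaussianLaw (fun ω i => X i ω) P) (hX0 : ∀ i, ∫ ω, X i ω ∂P = 0) :
    ∫ ω, range (fun i => X i ω) ∂P = 2 * ∫ ω, ⨆ i, X i ω ∂P := by
  have hi (i : κ) := (hX.eval i).integrable
  have hneg : HasGaussianLaw (fun ω i => -X i ω) P := hX.fun_neg
  have hlaw : P.map (fun ω i => X i ω) = P.map (fun ω i => -X i ω) :=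
    hX.map_eq_of_covariance_eq (Y := fun i ω => -X i ω) hneg hX0
      (fun i => by rw [integral_neg, hX0, neg_zero])
      fun i j => by rw [covariance_fun_neg_left, covariance_fun_neg_right, neg_neg]
  have hm : Measurable fun x : κ → ℝ => ⨆ i, x i := Measurable.iSup fun i => by fun_prop
  have e : ∫ ω, ⨆ i, -X i ω ∂P = ∫ ω, ⨆ i, X i ω ∂P := by
    have h1 := integral_map hX.aemeasurable hm.aestronglyMeasurable
    have h2 := integral_map hneg.aemeasurable hm.aestronglyMeasurable
    rw [← h1, ← h2, hlaw]
  simp only [range_eq_iSup_add_iSup_neg]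
  rw [integral_add (integrable_iSup_of_fintype hi)
    (integrable_iSup_of_fintype (X := fun i ω => -X i ω) fun i => (hi i).neg), e]
  ring

/-- Sudakov-Fernique inequality for the expected maxima of Gaussian vectors. -/
theorem ProbabilityTheory.HasGaussianLaw.integral_iSup_le {X : κ → Ω → ℝ} {Y : κ → Ω' → ℝ}
    (hX : HasGaussianLaw (fun ω i => X i ω) P) (hY : HasGaussianLaw (fun ω i => Y i ω) P')
    (hX0 : ∀ i, ∫ ω, X i ω ∂P = 0) (hY0 : ∀ i, ∫ ω, Y i ω ∂P' = 0)
    (hle : ∀ i j, cov[X i, X i; P] + cov[X j, X j; P] - 2 * cov[X i, X j; P] ≤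
      cov[Y i, Y i; P'] + cov[Y j, Y j; P'] - 2 * cov[Y i, Y j; P']) :
    ∫ ω, ⨆ i, X i ω ∂P ≤ ∫ ω, ⨆ i, Y i ω ∂P' := by
  -- At a = 0 the positive part is the range itself.
  have h := hX.integral_posPart_range_sub_le hY hX0 hY0 hle le_rfl
  simp only [sub_zero, max_eq_left (range_nonneg _)] at h
  rw [hX.integral_range_eq hX0, hY.integral_range_eq hY0] at h
  linarith

end Maximum

/-! ### Comparison theorems for continuous Gaussian processes -/

section PathComparison

variable {Ω Ω' : Type*} [MeasurableSpace Ω] [MeasurableSpace Ω'] {P : Measure Ω} {P' : Measure Ω'}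
  {S : Type*} [TopologicalSpace S] [CompactSpace S] [TopologicalSpace.SeparableSpace S] [Nonempty S]

/-- Sudakov-Fernique inequality for the expected suprema of continuous Gaussian processes. -/
theorem integral_iSup_path_le {X : S → Ω → ℝ} {Y : S → Ω' → ℝ}
    (hX : IsGaussianProcess X P) (hY : IsGaussianProcess Y P')
    (hX0 : ∀ t, ∫ ω, X t ω ∂P = 0) (hY0 : ∀ t, ∫ ω, Y t ω ∂P' = 0)
    (hXc : ∀ᵐ ω ∂P, Continuous fun t => X t ω) (hYc : ∀ᵐ ω ∂P', Continuous fun t => Y t ω)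
    (hle : ∀ s t, cov[X s, X s; P] + cov[X t, X t; P] - 2 * cov[X s, X t; P] ≤
      cov[Y s, Y s; P'] + cov[Y t, Y t; P'] - 2 * cov[Y s, Y t; P']) :
    ∫ ω, ⨆ t, X t ω ∂P ≤ ∫ ω, ⨆ t, Y t ω ∂P' :=
  le_of_tendsto_of_tendsto' (tendsto_integral_iSup_densePoints hX hX0 hXc)
    (tendsto_integral_iSup_densePoints hY hY0 hYc) fun n =>
      (hX.hasGaussianLaw_comp (densePoints S n)).integral_iSup_le
        (hY.hasGaussianLaw_comp (densePoints S n)) (fun _ => hX0 _) (fun _ => hY0 _)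
        (fun _ _ => hle _ _)

/-- Extends g from the half-line to a convex function on ℝ, as the mixture argument requires;
monotonicity is what preserves convexity across 0. -/
theorem ConvexOn.comp_max_zero {g : ℝ → ℝ} (hg : MonotoneOn g (Set.Ici 0))
    (hgc : ConvexOn ℝ (Set.Ici 0) g) : ConvexOn ℝ Set.univ fun x => g (max x 0) := by
  refine ⟨convex_univ, fun x _ y _ a b ha hb hab => ?_⟩
  simp only [smul_eq_mul]
  refine (hg (Set.mem_Ici.2 (le_max_right _ _)) ?_ ?_).trans
    (hgc.2 (le_max_right x 0) (le_max_right y 0) ha hb hab)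
  · exact add_nonneg (mul_nonneg ha (le_max_right _ _)) (mul_nonneg hb (le_max_right _ _))
  · refine max_le ?_ ?_
    · exact add_le_add (mul_le_mul_of_nonneg_left (le_max_left _ _) ha)
        (mul_le_mul_of_nonneg_left (le_max_left _ _) hb)
    · exact add_nonneg (mul_nonneg ha (le_max_right _ _)) (mul_nonneg hb (le_max_right _ _))

/-- Fernique's comparison of the ranges of two continuous Gaussian processes in the increasing
convex order. -/
theorem extExpectation_range_path_le {X : S → Ω → ℝ} {Y : S → Ω' → ℝ}
    (hX : IsGaussianProcess X P) (hY : IsGaussianProcess Y P')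
    (hX0 : ∀ t, ∫ ω, X t ω ∂P = 0) (hY0 : ∀ t, ∫ ω, Y t ω ∂P' = 0)
    (hXc : ∀ᵐ ω ∂P, Continuous fun t => X t ω) (hYc : ∀ᵐ ω ∂P', Continuous fun t => Y t ω)
    (hle : ∀ s t, cov[X s, X s; P] + cov[X t, X t; P] - 2 * cov[X s, X t; P] ≤
      cov[Y s, Y s; P'] + cov[Y t, Y t; P'] - 2 * cov[Y s, Y t; P'])
    {g : ℝ → ℝ} (hg : MonotoneOn g (Set.Ici 0)) (hgc : ConvexOn ℝ (Set.Ici 0) g) :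
    extExpectation P (fun ω => g (range fun t => X t ω)) ≤
      extExpectation P' (fun ω => g (range fun t => Y t ω)) := by
  have := hX.isProbabilityMeasure
  have := hY.isProbabilityMeasure
  have hgm : Monotone fun x => g (max x 0) := fun x y hxy =>
    hg (Set.mem_Ici.2 (le_max_right _ _)) (Set.mem_Ici.2 (le_max_right _ _)) (max_le_max_right 0 hxy)
  have hmX := aemeasurable_range_path hX.aemeasurable hXc
  have hmY := aemeasurable_range_path hY.aemeasurable hYc
  have e {x : ℝ} (hx : 0 ≤ x) : g x = g (max x 0) := by rw [max_eq_left hx]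
  have key := lintegral_convex_le hmX hmY (fun ω => range_nonneg _) (fun ω => range_nonneg _)
    (fun a ha => lintegral_range_path_sub_le hX hY hX0 hY0 hXc hYc hle ha) hgm
    (hgc.comp_max_zero hg)
  simp only [e (range_nonneg _)]
  -- Both expectations are shifted by the same constant g(0), the least value of g on ranges.
  have eX := extExpectation_eq_of_le (P := P) (f := fun ω => g (max (range fun t => X t ω) 0))
    (c := g (max 0 0)) (hgm.measurable.comp_aemeasurable hmX) fun ω => hgm (range_nonneg _)
  have eY := extExpectation_eq_of_le (P := P') (f := fun ω => g (max (range fun t => Y t ω) 0))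
    (c := g (max 0 0)) (hgm.measurable.comp_aemeasurable hmY) fun ω => hgm (range_nonneg _)
  rw [eX, eY]
  exact add_le_add (by exact_mod_cast key) le_rfl

end PathComparison

/-! ### Bifractional against scaled fractional Brownian motion -/

theorem theorem2p6 {Ω Ω' : Type*} [MeasurableSpace Ω] [MeasurableSpace Ω']
    (P : Measure Ω) [IsProbabilityMeasure P] (P' : Measure Ω') [IsProbabilityMeasure P']
    (H K T : ℝ) (hH0 : 0 < H) (hH1 : H < 1) (hK0 : 0 < K) (hK1 : K ≤ 1) (hT : 0 < T)
    (W : Set.Icc (0 : ℝ) T → Ω → ℝ) (hW : IsBifractionalBM H K T W P)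
    (hWc : ∀ᵐ ω ∂P, Continuous fun t => W t ω)
    (B : Set.Icc (0 : ℝ) T → Ω' → ℝ) (hB : IsFractionalBM (H * K) T B P')
    (hBc : ∀ᵐ ω ∂P', Continuous fun t => B t ω)
    (Y : Set.Icc (0 : ℝ) T → Ω' → ℝ) (hY : ∀ t ω, Y t ω = (2 : ℝ) ^ (-K / 2) * B t ω) :
    (∀ g : ℝ → ℝ, MonotoneOn g (Set.Ici 0) → ConvexOn ℝ (Set.Ici 0) g →
      extExpectation P' (fun ω => g (⨆ p : Set.Icc (0 : ℝ) T × Set.Icc (0 : ℝ) T,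
          (Y p.1 ω - Y p.2 ω)))
        ≤ extExpectation P (fun ω => g (⨆ p : Set.Icc (0 : ℝ) T × Set.Icc (0 : ℝ) T,
          (W p.1 ω - W p.2 ω)))) ∧
    (Integrable (fun ω => ⨆ t, W t ω) P ∧ Integrable (fun ω => ⨆ t, Y t ω) P' ∧
      ∫ ω, (⨆ t, Y t ω) ∂P' ≤ ∫ ω, (⨆ t, W t ω) ∂P) := by
  have : Nonempty (Set.Icc (0 : ℝ) T) := ⟨⟨0, Set.left_mem_Icc.2 hT.le⟩⟩
  obtain rfl : Y = fun t ω => (2 : ℝ) ^ (-K / 2) * B t ω := funext fun t => funext fun ω => hY t ω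
  have hYg : IsGaussianProcess (fun t ω => (2 : ℝ) ^ (-K / 2) * B t ω) P' :=
    hB.gaussian.smul fun _ => (2 : ℝ) ^ (-K / 2)
  have hY0 (t : Set.Icc (0 : ℝ) T) : ∫ ω, (2 : ℝ) ^ (-K / 2) * B t ω ∂P' = 0 := by
    rw [integral_const_mul, hB.centered, mul_zero]
  have hYc : ∀ᵐ ω ∂P', Continuous fun t => (2 : ℝ) ^ (-K / 2) * B t ω := by
    filter_upwards [hBc] with ω hω using hω.const_mul _
  have hsq : (2 : ℝ) ^ (-K / 2) * (2 : ℝ) ^ (-K / 2) = 1 / 2 ^ K := by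
    rw [← Real.rpow_add two_pos, one_div, ← Real.rpow_neg two_pos.le]
    ring_nf
  have hcov (s t : Set.Icc (0 : ℝ) T) : cov[fun ω => (2 : ℝ) ^ (-K / 2) * B s ω,
      fun ω => (2 : ℝ) ^ (-K / 2) * B t ω; P'] = 1 / 2 ^ K * fBmCov (H * K) s t := by
    rw [covariance_const_mul_left, covariance_const_mul_right, hB.covariance_eq, ← mul_assoc, hsq]
  have hle (s t : Set.Icc (0 : ℝ) T) :
      cov[fun ω => (2 : ℝ) ^ (-K / 2) * B s ω, fun ω => (2 : ℝ) ^ (-K / 2) * B s ω; P'] +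
        cov[fun ω => (2 : ℝ) ^ (-K / 2) * B t ω, fun ω => (2 : ℝ) ^ (-K / 2) * B t ω; P'] -
        2 * cov[fun ω => (2 : ℝ) ^ (-K / 2) * B s ω, fun ω => (2 : ℝ) ^ (-K / 2) * B t ω; P'] ≤
      cov[W s, W s; P] + cov[W t, W t; P] - 2 * cov[W s, W t; P] := by
    -- The scaled fractional motion has increment variance exactly 2^{-K}|t - s|^{2HK}, the lower
    -- bound in `le_bifBmCov_increment`.
    have h1 := fBmCov_increment (s := s) (t := t) (mul_pos hH0 hK0)
    have h2 := le_bifBmCov_increment hH0 hH1 hK0 hK1 s.2.1 t.2.1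
    simp only [hcov, hW.covariance_eq]
    rw [← h1] at h2
    linarith
  exact ⟨fun g hg hgc => extExpectation_range_path_le hYg hW.gaussian hY0 hW.centered hYc hWc hle
      hg hgc,
    integrable_iSup_path hW.gaussian hW.centered hWc, integrable_iSup_path hYg hY0 hYc,
    integral_iSup_path_le hYg hW.gaussian hY0 hW.centered hYc hWc hle⟩
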